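/- **Setting.** Let $m, n : \mathbb{N} \to \mathbb{N}$ be functions of the security parameter $\lambda$ (write $m = m(\lambda)$, $n = n(\lambda)$), and for every $\lambda$ let $\{F_k : \{0,1\}^{m+n} \to \{0,1\}\}_{k \in \{0,1\}^\lambda}$ be a family of keyed functions; call the whole family $\mathfrak{F}$. Let $\epsilon : \mathbb{N} \to \mathbb{R}$. We say that $\mathfrak{F}$ is $(2^{m+n}, \epsilon(\lambda))$-*classically secure* if for every classical probabilistic oracle algorithm $D$ that on input $(\lambda, m(\lambda), n(\lambda))$ runs in time $\mathrm{poly}(2^{m(\lambda)+n(\lambda)})$ (for every oracle and all coins), and for all sufficiently large $\lambda$, $$\left| \Pr_{k \gets \{0,1\}^\lambda}\left[D^{F_k} = 1\right] - \Pr_{f}\left[D^{f} = 1\right] \right| \le \epsilon(\lambda),$$ where $f : \{0,1\}^{m+n} \to \{0,1\}$ is uniformly random. A *monogamy of entanglement game* $\mathsf{G}$ with Alice's space $\mathcal{H}_A$, finite question set $\Theta$ and finite answer set $\mathcal{X}$ is given by a POVM $\{A_x^\theta\}_{x \in \mathcal{X}}$ on $\mathcal{H}_A$ for each $\theta \in \Theta$.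 A strategy consists of finite-dimensional Hilbert spaces $\mathcal{H}_B, \mathcal{H}_C$, a density matrix $\rho$ on $\mathcal{H}_A \otimes \mathcal{H}_B \otimes \mathcal{H}_C$, and POVMs $\{B_x^\theta\}_{x \in \mathcal{X}}$ on $\mathcal{H}_B$ and $\{C_x^\theta\}_{x \in \mathcal{X}}$ on $\mathcal{H}_C$ for each $\theta \in \Theta$. The value of the game is $$\omega(\mathsf{G}) = \sup \; \mathop{\mathbb{E}}_{\theta \in \Theta} \sum_{x \in \mathcal{X}} \mathrm{Tr}\left[(A_x^\theta \otimes B_x^\theta \otimes C_x^\theta)\,\rho\right],$$ the supremum being over all strategies and $\theta$ being uniformly random. (So Bob and Charlie are computationally unbounded and receive $\theta$ in the clear.) For $k \in \{0,1\}^\lambda$, the *salted binary-phase monogamy game* $\mathsf{G}_{\mathfrak{F}, k}$ has $\mathcal{H}_A = \mathbb{C}^{2^n}$, $\Theta = \{0,1\}^m$, $\mathcal{X} = \{0,1\}^n$ and $A_x^\theta = V_\theta |x\rangle\langle x| V_\theta^\dagger$, where $V_\theta = U_{f_{k,\theta}} H^{\otimes n}$, $f_{k,\theta}(x) = F_k(\theta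 \| x)$, $U_f = \sum_{x} (-1)^{f(x)} |x\rangle\langle x|$, and $H^{\otimes n} = 2^{-n/2} \sum_{x,y} (-1)^{\langle x, y\rangle} |x\rangle\langle y|$. **Theorem.** There is a universal constant $C > 0$ such that, for all $m, n, \mathfrak{F}, \epsilon$ as above with $\mathfrak{F}$ being $(2^{m+n}, \epsilon(\lambda))$-classically secure, and for all sufficiently large $\lambda$, $$\Pr_{k \gets \{0,1\}^\lambda}\left[\, \omega(\mathsf{G}_{\mathfrak{F}, k}) \le C\left(2^{-m} + 2^{-n/2}\sqrt{m+n}\right) \right] \ge 1 - C \cdot 2^{-n} - \epsilon(\lambda).$$ -/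

import Mathlib

open Filter MeasureTheory
open scoped BigOperators Kronecker ComplexOrder

/-- Bit strings of length `n`. -/
abbrev BitString (n : ℕ) : Type := Fin n → Bool

/-- The probability of the event `p` for a uniformly random element of the finite type `α`. -/
noncomputable def uniformProb {α : Type} [Fintype α] (p : α → Prop) : ℝ :=
  ({a | p a}.ncard : ℝ) / (Fintype.card α : ℝ)

/-- The expectation of `g` at a uniformly random element of the finite type `α`. -/
noncomputable def uniformMean {α : Type} [Fintype α] (g : α → ℝ) : ℝ :=
  (∑ a, g a) / (Fintype.card α : ℝ)

section Algorithms

/-! Classical probabilistic oracle algorithms with a step count.  A program works on registers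
that hold natural numbers in binary; a program mentions only finitely many of them.  An
instruction costs one step plus the bit lengths of the numbers that it handles (logarithmic cost),
so that running times agree with those of probabilistic multi-tape oracle Turing machines up to a
polynomial (doubling and halving a register simulate a stack). -/

/-- Programs; register names are natural numbers. -/
inductive Program : Type
  /-- `r := c` -/
  | const (r c : ℕ)
  /-- `r := a + b` -/
  | add (r a b : ℕ)
  /-- `r := a - b`, truncated at zero -/
  | sub (r a b : ℕ)
  /-- `r := ⌊a / 2⌋` -/
  | half (r a : ℕ)
  /-- `r :=` a fresh fair coin -/
  | toss (r : ℕ)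
  /-- `r :=` the answer of the oracle to the query held by register `a` -/
  | query (r a : ℕ)
  | seq (p q : Program)
  /-- if register `a` is nonzero then `p` else `q` -/
  | ite (a : ℕ) (p q : Program)
  /-- while register `a` is nonzero do `p` -/
  | loop (a : ℕ) (p : Program)

/-- The contents of the registers and the coins that are still unused. -/
structure MachineState where
  reg : ℕ → ℕ
  coins : ℕ → Bool

/-- Write the value `v` to register `r`. -/
def MachineState.write (s : MachineState) (r v : ℕ) : MachineState :=
  { s with reg := Function.update s.reg r v }

/-- `Exec O p s t s'`: with oracle `O`, the program `p` started in the state `s` halts after `t`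
steps in the state `s'`.  Here `Nat.size` is the bit length. -/
inductive Exec (O : ℕ → Bool) : Program → MachineState → ℕ → MachineState → Prop
  | const (r c : ℕ) (s : MachineState) :
      Exec O (.const r c) s (1 + c.size) (s.write r c)
  | add (r a b : ℕ) (s : MachineState) :
      Exec O (.add r a b) s (1 + (s.reg a).size + (s.reg b).size)
        (s.write r (s.reg a + s.reg b))
  | sub (r a b : ℕ) (s : MachineState) :
      Exec O (.sub r a b) s (1 + (s.reg a).size + (s.reg b).size)
        (s.write r (s.reg a - s.reg b))
  | half (r a : ℕ) (s : MachineState) :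
      Exec O (.half r a) s (1 + (s.reg a).size) (s.write r (s.reg a / 2))
  | toss (r : ℕ) (s : MachineState) :
      Exec O (.toss r) s 1
        { reg := Function.update s.reg r (s.coins 0).toNat, coins := fun i => s.coins (i + 1) }
  | query (r a : ℕ) (s : MachineState) :
      Exec O (.query r a) s (1 + (s.reg a).size) (s.write r (O (s.reg a)).toNat)
  | seq {p q : Program} {s s' s'' : MachineState} {t t' : ℕ} :
      Exec O p s t s' → Exec O q s' t' s'' → Exec O (.seq p q) s (t + t') s''
  | ite_true {a : ℕ} {p q : Program} {s s' : MachineState} {t : ℕ} :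
      s.reg a ≠ 0 → Exec O p s t s' → Exec O (.ite a p q) s (1 + t) s'
  | ite_false {a : ℕ} {p q : Program} {s s' : MachineState} {t : ℕ} :
      s.reg a = 0 → Exec O q s t s' → Exec O (.ite a p q) s (1 + t) s'
  | loop_done {a : ℕ} {p : Program} {s : MachineState} :
      s.reg a = 0 → Exec O (.loop a p) s 1 s
  | loop_step {a : ℕ} {p : Program} {s s' s'' : MachineState} {t t' : ℕ} :
      s.reg a ≠ 0 → Exec O p s t s' → Exec O (.loop a p) s' t' s'' →
        Exec O (.loop a p) s (1 + t + t') s''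

/-- Oracle access to a function on bit strings of length `N`: a query is read as the string of
its `N` lowest binary digits, digit `i` being entry `i` of the string. -/
def bitOracle {N : ℕ} (f : BitString N → Bool) (v : ℕ) : Bool :=
  f fun i => v.testBit i

/-- The start of a distinguisher: registers `0`, `1`, `2` hold the security parameter `ℓ` and the
lengths `m`, `n`, all other registers are zero. -/
def startState (ℓ m n : ℕ) (coins : ℕ → Bool) : MachineState where
  reg := fun r => if r = 0 then ℓ else if r = 1 then m else if r = 2 then n else 0
  coins := coins

/-- The distribution of an infinite sequence of independent fair coins. -/
noncomputable def coinMeasure : Measure (ℕ → Bool) :=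
  Measure.infinitePi fun _ : ℕ => (PMF.uniformOfFintype Bool).toMeasure

/-- The probability over its coins that the program `D`, with oracle `f`, halts with output `1`,
that is, with a nonzero number in register `0`. -/
noncomputable def acceptProb (D : Program) (ℓ : ℕ) {m n : ℕ} (f : BitString (m + n) → Bool) : ℝ :=
  coinMeasure.real
    {ω | ∃ t s', Exec (bitOracle f) D (startState ℓ m n ω) t s' ∧ s'.reg 0 ≠ 0}

/-- `D` runs in time `poly(T(ℓ))`: whatever the oracle and the coins. -/
def RunsInPolyTimeOf (D : Program) (m n T : ℕ → ℕ) : Prop :=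
  ∃ p : Polynomial ℕ, ∀ (ℓ : ℕ) (f : BitString (m ℓ + n ℓ) → Bool) (ω : ℕ → Bool),
    ∃ t s', Exec (bitOracle f) D (startState ℓ (m ℓ) (n ℓ) ω) t s' ∧ t ≤ p.eval (T ℓ)

/-- The advantage of `D` in distinguishing `F k`, for a uniformly random key `k` of length `ℓ`,
from a uniformly random function. -/
noncomputable def prfAdvantage (D : Program) {ℓ m n : ℕ}
    (F : BitString ℓ → BitString (m + n) → Bool) : ℝ :=
  |uniformMean (fun k : BitString ℓ => acceptProb D ℓ (F k)) -
    uniformMean (fun f : BitString (m + n) → Bool => acceptProb D ℓ f)|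

/-- The family `F` of keyed functions is `(T, ε)`-classically secure: every classical
distinguisher that runs in time `poly(T(ℓ))` has advantage at most `ε(ℓ)`, for all sufficiently
large values of the security parameter `ℓ`. -/
def IsClassicallySecurePRF {m n : ℕ → ℕ}
    (F : ∀ ℓ : ℕ, BitString ℓ → BitString (m ℓ + n ℓ) → Bool) (T : ℕ → ℕ) (ε : ℕ → ℝ) : Prop :=
  ∀ D : Program, RunsInPolyTimeOf D m n T → ∀ᶠ ℓ in atTop, prfAdvantage D (F ℓ) ≤ ε ℓ

end Algorithms

section Games

/-- Positive operator-valued measurements on `ℂ^A` with outcomes in `X`. -/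
structure IsPOVM {A X : Type} [Fintype A] [DecidableEq A] [Fintype X]
    (M : X → Matrix A A ℂ) : Prop where
  posSemidef : ∀ x, (M x).PosSemidef
  sum_eq_one : ∑ x, M x = 1

/-- Monogamy of entanglement games with Alice's space `ℂ^A`, question set `Θ`, answer set `X`. -/
structure MonogamyGame (A Θ X : Type) [Fintype A] [DecidableEq A] [Fintype X] where
  alice : Θ → X → Matrix A A ℂ
  isPOVM : ∀ θ, IsPOVM (alice θ)

/-- Strategies of Bob and Charlie: spaces `ℂ^dB` and `ℂ^dC` of any finite dimensions, a density
matrix on `A ⊗ B ⊗ C`, and for each question a measurement of Bob and one of Charlie. -/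
structure QuantumStrategy (A Θ X : Type) [Fintype A] [DecidableEq A] [Fintype X] where
  dB : ℕ
  dC : ℕ
  ρ : Matrix (A × (Fin dB × Fin dC)) (A × (Fin dB × Fin dC)) ℂ
  bob : Θ → X → Matrix (Fin dB) (Fin dB) ℂ
  charlie : Θ → X → Matrix (Fin dC) (Fin dC) ℂ
  ρ_posSemidef : ρ.PosSemidef
  ρ_trace : ρ.trace = 1
  bob_isPOVM : ∀ θ, IsPOVM (bob θ)
  charlie_isPOVM : ∀ θ, IsPOVM (charlie θ)

variable {A Θ X : Type} [Fintype A] [DecidableEq A] [Fintype Θ] [Fintype X]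

/-- The winning probability of a strategy, for a uniformly random question (the trace is real). -/
noncomputable def MonogamyGame.winProb (G : MonogamyGame A Θ X) (S : QuantumStrategy A Θ X) : ℝ :=
  uniformMean fun θ : Θ =>
    ∑ x, (Matrix.trace ((G.alice θ x ⊗ₖ (S.bob θ x ⊗ₖ S.charlie θ x)) * S.ρ)).re

open scoped MatrixOrder Matrix.Norms.L2Operator in
theorem MonogamyGame.winProb_le_one (G : MonogamyGame A Θ X) (S : QuantumStrategy A Θ X) :
    G.winProb S ≤ 1 := by
  classical
  have key : ∀ θ, ∑ x,
      (Matrix.trace ((G.alice θ x ⊗ₖ (S.bob θ x ⊗ₖ S.charlie θ x)) * S.ρ)).re ≤ 1 := by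
    intro θ
    have hnn : ∀ x y z,
        0 ≤ (Matrix.trace ((G.alice θ x ⊗ₖ (S.bob θ y ⊗ₖ S.charlie θ z)) * S.ρ)).re := by
      intro x y z
      have hp := ((G.isPOVM θ).posSemidef x).kronecker
        (((S.bob_isPOVM θ).posSemidef y).kronecker ((S.charlie_isPOVM θ).posSemidef z))
      obtain ⟨R, hR⟩ := CStarAlgebra.nonneg_iff_eq_star_mul_self.mp S.ρ_posSemidef.nonneg
      rw [hR, Matrix.star_eq_conjTranspose, ← Matrix.mul_assoc, Matrix.trace_mul_comm, ← Matrix.mul_assoc]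
      exact (Complex.nonneg_iff.mp (hp.mul_mul_conjTranspose_same R).trace_nonneg).1
    have hsum : ∑ x, ∑ y, ∑ z,
        (Matrix.trace ((G.alice θ x ⊗ₖ (S.bob θ y ⊗ₖ S.charlie θ z)) * S.ρ)).re = 1 := by
      have h1 : ∑ x, ∑ y, ∑ z, G.alice θ x ⊗ₖ (S.bob θ y ⊗ₖ S.charlie θ z) = 1 := by
        ext i j
        have ha := congrFun (congrFun (G.isPOVM θ).sum_eq_one i.1) j.1
        have hb := congrFun (congrFun (S.bob_isPOVM θ).sum_eq_one i.2.1) j.2.1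
        have hc := congrFun (congrFun (S.charlie_isPOVM θ).sum_eq_one i.2.2) j.2.2
        simp only [Matrix.sum_apply] at ha hb hc
        simp only [Matrix.sum_apply, Matrix.kroneckerMap_apply, ← Finset.mul_sum, hc,
          ← Finset.sum_mul, hb, ha]
        rw [← Matrix.one_kronecker_one, ← Matrix.one_kronecker_one]
        rfl
      rw [← Complex.one_re, ← S.ρ_trace]
      conv_rhs => rw [← Matrix.one_mul S.ρ, ← h1]
      simp only [Finset.sum_mul, Matrix.trace_sum, Complex.re_sum]
    rw [← hsum]
    refine Finset.sum_le_sum fun x _ => ?_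
    refine le_trans ?_ (Finset.single_le_sum
      (fun y _ => Finset.sum_nonneg fun z _ => hnn x y z) (Finset.mem_univ x))
    exact Finset.single_le_sum (fun z _ => hnn x x z) (Finset.mem_univ x)
  rw [MonogamyGame.winProb, uniformMean]
  refine div_le_one_of_le₀ ?_ (Nat.cast_nonneg _)
  refine (Finset.sum_le_sum fun θ _ => key θ).trans ?_
  simp

/-- The value of the game: the supremum of the winning probabilities over all strategies. -/
noncomputable def MonogamyGame.value (G : MonogamyGame A Θ X) : ℝ :=
  ⨆ S : QuantumStrategy A Θ X, G.winProb S

/-- The supremum that defines the value is over a bounded set. -/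
theorem MonogamyGame.bddAbove_winProb (G : MonogamyGame A Θ X) :
    BddAbove (Set.range G.winProb) :=
  ⟨1, by rintro _ ⟨S, rfl⟩; exact G.winProb_le_one S⟩

end Games

section BinaryPhase

/-- The sign `(-1)^⟨x, y⟩`. -/
def innerSign {n : ℕ} (x y : BitString n) : ℂ :=
  ∏ i, (-1 : ℂ) ^ (x i && y i).toNat

/-- The phase unitary `U_f = ∑ₓ (-1)^{f(x)} |x⟩⟨x|`. -/
def phaseUnitary {n : ℕ} (f : BitString n → Bool) : Matrix (BitString n) (BitString n) ℂ :=
  Matrix.diagonal fun x => (-1 : ℂ) ^ (f x).toNat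

/-- The Hadamard unitary `2^{-n/2} ∑_{x, y} (-1)^⟨x, y⟩ |x⟩⟨y|` on `n` qubits. -/
noncomputable def hadamard (n : ℕ) : Matrix (BitString n) (BitString n) ℂ :=
  Matrix.of fun x y => (((2 : ℝ) ^ (-(n : ℝ) / 2) : ℝ) : ℂ) * innerSign x y

/-- The unitary `V_θ = U_{f_{k, θ}} H^{⊗ n}` for `g = F_k`, where `f_{k, θ}(x) = F_k(θ ‖ x)`. -/
noncomputable def saltedUnitary {m n : ℕ} (g : BitString (m + n) → Bool) (θ : BitString m) :
    Matrix (BitString n) (BitString n) ℂ :=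
  phaseUnitary (fun x => g (Fin.append θ x)) * hadamard n

/-- Alice's projector `A_x^θ = V_θ |x⟩⟨x| V_θ†`. -/
noncomputable def saltedProjector {m n : ℕ} (g : BitString (m + n) → Bool) (θ : BitString m)
    (x : BitString n) : Matrix (BitString n) (BitString n) ℂ :=
  saltedUnitary g θ * Matrix.single x x 1 * (saltedUnitary g θ).conjTranspose

theorem innerSign_comm {n : ℕ} (x y : BitString n) : innerSign x y = innerSign y x := by
  simp [innerSign, Bool.and_comm]

theorem innerSign_orthogonal {n : ℕ} (x y : BitString n) :
    ∑ z, innerSign x z * innerSign y z = if x = y then (2 : ℂ) ^ n else 0 := by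
  have h1 : ∀ z : BitString n, innerSign x z * innerSign y z =
      ∏ i, ((-1 : ℂ) ^ (x i && z i).toNat * (-1 : ℂ) ^ (y i && z i).toNat) := fun z => by
    simp only [innerSign, Finset.prod_mul_distrib]
  have h2 : ∀ a b : Bool, ∑ c : Bool, ((-1 : ℂ) ^ (a && c).toNat * (-1 : ℂ) ^ (b && c).toNat) =
      if a = b then 2 else 0 := by
    intro a b
    cases a <;> cases b <;> norm_num
  simp only [h1]
  rw [← Fintype.prod_sum (fun i c => (-1 : ℂ) ^ (x i && c).toNat * (-1 : ℂ) ^ (y i && c).toNat)]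
  simp only [h2]
  split_ifs with h
  · subst h
    simp
  · obtain ⟨i, hi⟩ := Function.ne_iff.mp h
    exact Finset.prod_eq_zero (Finset.mem_univ i) (by simp [hi])

theorem hadamard_mul_conjTranspose (n : ℕ) : hadamard n * (hadamard n).conjTranspose = 1 := by
  have hc : ((2 : ℝ) ^ (-(n : ℝ) / 2)) * ((2 : ℝ) ^ (-(n : ℝ) / 2)) * 2 ^ n = 1 := by
    rw [← Real.rpow_add two_pos, ← Real.rpow_natCast, ← Real.rpow_add two_pos]
    rw [show -(n : ℝ) / 2 + -(n : ℝ) / 2 + n = 0 by ring, Real.rpow_zero]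
  have hstar : ∀ x y : BitString n, star (innerSign x y) = innerSign x y := fun x y => by
    simp [innerSign]
  ext x y
  simp only [hadamard, Matrix.mul_apply, Matrix.conjTranspose_apply, Matrix.of_apply, star_mul',
    hstar, Matrix.one_apply]
  have h : ∀ z : BitString n,
      (((2 : ℝ) ^ (-(n : ℝ) / 2) : ℝ) : ℂ) * innerSign x z *
        (star (((2 : ℝ) ^ (-(n : ℝ) / 2) : ℝ) : ℂ) * innerSign y z) =
      (((2 : ℝ) ^ (-(n : ℝ) / 2) * (2 : ℝ) ^ (-(n : ℝ) / 2) : ℝ) : ℂ) *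
        (innerSign x z * innerSign y z) := fun z => by
    rw [show star (((2 : ℝ) ^ (-(n : ℝ) / 2) : ℝ) : ℂ) = (((2 : ℝ) ^ (-(n : ℝ) / 2) : ℝ) : ℂ) from
      Complex.conj_ofReal _]
    push_cast
    ring
  simp only [h]
  rw [← Finset.mul_sum, innerSign_orthogonal]
  split_ifs
  · exact_mod_cast hc
  · simp

theorem phaseUnitary_mul_conjTranspose {n : ℕ} (f : BitString n → Bool) :
    phaseUnitary f * (phaseUnitary f).conjTranspose = 1 := by
  rw [phaseUnitary, Matrix.diagonal_conjTranspose, Matrix.diagonal_mul_diagonal,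
    ← Matrix.diagonal_one]
  congr 1
  funext x
  cases h : f x <;> simp [h]

theorem saltedUnitary_mul_conjTranspose {m n : ℕ} (g : BitString (m + n) → Bool)
    (θ : BitString m) : saltedUnitary g θ * (saltedUnitary g θ).conjTranspose = 1 := by
  rw [saltedUnitary, Matrix.conjTranspose_mul, Matrix.mul_assoc,
    ← Matrix.mul_assoc (hadamard n), hadamard_mul_conjTranspose, Matrix.one_mul,
    phaseUnitary_mul_conjTranspose]

theorem saltedProjector_isPOVM {m n : ℕ} (g : BitString (m + n) → Bool) (θ : BitString m) :
    IsPOVM (saltedProjector g θ) where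
  posSemidef x := by
    refine Matrix.PosSemidef.mul_mul_conjTranspose_same ?_ _
    rw [← Matrix.diagonal_single]
    refine Matrix.PosSemidef.diagonal fun y => ?_
    by_cases h : y = x
    · subst h; simp
    · simp [h]
  sum_eq_one := by
    have h : ∑ x : BitString n, Matrix.single x x (1 : ℂ) = 1 := by
      ext i j
      simp [Matrix.sum_apply, Matrix.single_apply, Matrix.one_apply, ite_and]
    simp only [saltedProjector]
    rw [← Finset.sum_mul, ← Finset.mul_sum, h, Matrix.mul_one, saltedUnitary_mul_conjTranspose]

/-- The salted binary-phase monogamy game of the function `g : {0,1}^{m+n} → {0,1}`, to be used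
with `g = F_k`: Alice's space is `ℂ^{2^n}`, the questions are `{0,1}^m`, the answers `{0,1}^n`. -/
noncomputable def saltedGame {m n : ℕ} (g : BitString (m + n) → Bool) :
    MonogamyGame (BitString n) (BitString m) (BitString n) where
  alice := saltedProjector g
  isPOVM := saltedProjector_isPOVM g

end BinaryPhase

/-! ### Execution of loop-free programs and rules for reasoning about running time -/

section Machine

/-! The value is controlled by the overlaps of Alice's bases. If all entries of `V_θ† V_θ'` with `θ
≠ θ'` are at most `c` in absolute value, then the value is at most `2^(-m) + c`
(`value_saltedGame_le`). To see this, let `W_θ` be the winning operator at `θ` and `s_θ = ⟨v, W_θ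
v⟩`. Commutation between the parties and Cauchy-Schwarz give `|⟨W_θ v, W_θ' v⟩| ≤ c (s_θ + s_θ') /
2`. Hence `‖∑ W_θ v‖² ≤ (1 + 2^m c) ∑ s_θ`, and as `∑ s_θ ≤ ‖v‖ ‖∑ W_θ v‖`, it follows that `∑ s_θ ≤
(1 + 2^m c) ‖v‖²`. Dividing by `2^m` gives the bound.

An overlap is `2^(-n)` times a sum of `2^n` signs determined by the function, the two salts and the
XOR `z` of the two answers (`overlap_eq`). For a random function the signs are independent. A
Chernoff bound and a union bound over the `2^(2m+n)` triples show that, except with probability `2 *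
2^(-n)`, every sum has square at most `4 * 2^n * (m+n)` (`uniformProb_isBiased_le`); then `c = 2 *
2^(-n/2) * √(m+n)` is admissible.

Whether some sum is too large is a property of the truth table, which exhaustive search decides in
time polynomial in `2^(m+n)` (`reaches_distinguisher`). Security therefore carries the probability
bound over to `F_k` with loss `ε`. The players' power is irrelevant, since the property bounds the
value against every strategy. -/

theorem Exec.deterministic {O : ℕ → Bool} {p : Program} {s s₁ : MachineState} {t₁ : ℕ}
    (h₁ : Exec O p s t₁ s₁) : ∀ {t₂ : ℕ} {s₂ : MachineState}, Exec O p s t₂ s₂ → s₁ = s₂ := by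
  induction h₁ with
  | const | add | sub | half | toss | query => intro t₂ s₂ h₂; cases h₂; rfl
  | seq _ _ ih ih' =>
    intro t₂ s₂ h₂
    cases h₂ with
    | seq g g' => cases ih g; exact ih' g'
  | ite_true h _ ih =>
    intro t₂ s₂ h₂
    cases h₂ with
    | ite_true _ g => exact ih g
    | ite_false h' _ => exact absurd h' h
  | ite_false h _ ih =>
    intro t₂ s₂ h₂
    cases h₂ with
    | ite_true h' _ => exact absurd h h'
    | ite_false _ g => exact ih g
  | loop_done h =>
    intro t₂ s₂ h₂
    cases h₂ with
    | loop_done _ => rfl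
    | loop_step h' _ _ => exact absurd h h'
  | loop_step h _ _ ih ih' =>
    intro t₂ s₂ h₂
    cases h₂ with
    | loop_done h' => exact absurd h' h
    | loop_step _ g g' => cases ih g; exact ih' g'

/-- Programs without coins and loops. -/
def Program.IsSimple : Program → Prop
  | .const _ _ | .add _ _ _ | .sub _ _ _ | .half _ _ | .query _ _ => True
  | .seq p q | .ite _ p q => p.IsSimple ∧ q.IsSimple
  | .toss _ | .loop _ _ => False

/-- The effect of a simple program on the registers. -/
def Program.effect (O : ℕ → Bool) : Program → (ℕ → ℕ) → ℕ → ℕ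
  | .const r c, ρ => Function.update ρ r c
  | .add r a b, ρ => Function.update ρ r (ρ a + ρ b)
  | .sub r a b, ρ => Function.update ρ r (ρ a - ρ b)
  | .half r a, ρ => Function.update ρ r (ρ a / 2)
  | .query r a, ρ => Function.update ρ r (O (ρ a)).toNat
  | .seq p q, ρ => q.effect O (p.effect O ρ)
  | .ite a p q, ρ => if ρ a = 0 then q.effect O ρ else p.effect O ρ
  | .toss _, ρ | .loop _ _, ρ => ρ

/-- An upper bound for the running time of a simple program. -/
def Program.cost (O : ℕ → Bool) : Program → (ℕ → ℕ) → ℕ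
  | .const _ c, _ => 1 + c
  | .add _ a b, ρ | .sub _ a b, ρ => 1 + ρ a + ρ b
  | .half _ a, ρ | .query _ a, ρ => 1 + ρ a
  | .seq p q, ρ => p.cost O ρ + q.cost O (p.effect O ρ)
  | .ite a p q, ρ => 1 + if ρ a = 0 then q.cost O ρ else p.cost O ρ
  | .toss _, _ | .loop _ _, _ => 0

/-- A simple program that writes to no register below `k`. -/
def Program.WritesFrom (k : ℕ) : Program → Prop
  | .const r _ | .add r _ _ | .sub r _ _ | .half r _ | .query r _ => k ≤ r
  | .seq p q | .ite _ p q => p.WritesFrom k ∧ q.WritesFrom k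
  | .toss _ | .loop _ _ => True

theorem Program.WritesFrom.effect_eq {O : ℕ → Bool} {k r : ℕ} (hr : r < k) {p : Program} :
    ∀ {ρ : ℕ → ℕ}, p.WritesFrom k → p.effect O ρ r = ρ r := by
  induction p with
  | const | add | sub | half | query =>
    exact fun h => Function.update_of_ne (hr.trans_le h).ne _ _
  -- `effect` is the identity here by convention; only simple programs give it a meaning.
  | toss | loop => exact fun _ => rfl
  | seq p q ihp ihq => exact fun h => (ihq h.2).trans (ihp h.1)
  | ite a p q ihp ihq =>
    intro ρ h
    rw [effect]
    split_ifs
    exacts [ihq h.2, ihp h.1]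

theorem Nat.size_le_self (a : ℕ) : a.size ≤ a := Nat.size_le.2 Nat.lt_two_pow_self

/-- With oracle `O` and register contents `ρ`, the program `p` halts within `T` steps, for all
coins, and the final register contents satisfy `Q`. -/
def Reaches (O : ℕ → Bool) (p : Program) (ρ : ℕ → ℕ) (T : ℕ) (Q : (ℕ → ℕ) → Prop) : Prop :=
  ∀ ω : ℕ → Bool, ∃ t ρ' ω', Exec O p ⟨ρ, ω⟩ t ⟨ρ', ω'⟩ ∧ t ≤ T ∧ Q ρ'

variable {O : ℕ → Bool} {p q : Program} {ρ : ℕ → ℕ} {T T₁ T₂ : ℕ} {Q Q' : (ℕ → ℕ) → Prop}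

/-- Bounding bit lengths by the numbers themselves is wasteful but harmless: the numbers handled by
the distinguisher are polynomial in `2^(m+n)`. -/
theorem Program.IsSimple.exists_exec {p : Program} (hp : p.IsSimple) (O : ℕ → Bool) (ω : ℕ → Bool) :
    ∀ ρ : ℕ → ℕ, ∃ t ≤ p.cost O ρ, Exec O p ⟨ρ, ω⟩ t ⟨p.effect O ρ, ω⟩ := by
  induction p with
  | const r c => exact fun ρ => ⟨_, by simpa [cost] using Nat.size_le_self c, Exec.const r c _⟩
  | add r a b =>
    exact fun ρ => ⟨_, Nat.add_le_add (Nat.add_le_add le_rfl (Nat.size_le_self _))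
      (Nat.size_le_self _), Exec.add r a b _⟩
  | sub r a b =>
    exact fun ρ => ⟨_, Nat.add_le_add (Nat.add_le_add le_rfl (Nat.size_le_self _))
      (Nat.size_le_self _), Exec.sub r a b _⟩
  | half r a => exact fun ρ => ⟨_, Nat.add_le_add le_rfl (Nat.size_le_self _), Exec.half r a _⟩
  | query r a => exact fun ρ => ⟨_, Nat.add_le_add le_rfl (Nat.size_le_self _), Exec.query r a _⟩
  | toss r => exact hp.elim
  | loop a p _ => exact hp.elim
  | seq p q ihp ihq =>
    intro ρ
    obtain ⟨t, ht, h⟩ := ihp hp.1 ρ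
    obtain ⟨t', ht', h'⟩ := ihq hp.2 (p.effect O ρ)
    exact ⟨t + t', Nat.add_le_add ht ht', h.seq h'⟩
  | ite a p q ihp ihq =>
    intro ρ
    by_cases ha : ρ a = 0
    · obtain ⟨t, ht, h⟩ := ihq hp.2 ρ
      exact ⟨1 + t, by simpa [cost, ha] using ht, by
        simpa [effect, ha] using Exec.ite_false (p := p) (s := ⟨ρ, ω⟩) ha h⟩
    · obtain ⟨t, ht, h⟩ := ihp hp.1 ρ
      exact ⟨1 + t, by simpa [cost, ha] using ht, by
        simpa [effect, ha] using Exec.ite_true (q := q) (s := ⟨ρ, ω⟩) ha h⟩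

theorem Reaches.simple (hp : p.IsSimple) (hT : p.cost O ρ ≤ T) (hQ : Q (p.effect O ρ)) :
    Reaches O p ρ T Q := fun ω =>
  let ⟨t, ht, h⟩ := hp.exists_exec O ω ρ
  ⟨t, _, ω, h, ht.trans hT, hQ⟩

theorem Reaches.mono (h : Reaches O p ρ T₁ Q) (hT : T₁ ≤ T) (hQ : ∀ ρ', Q ρ' → Q' ρ') :
    Reaches O p ρ T Q' := fun ω =>
  let ⟨t, ρ', ω', he, ht, hq⟩ := h ω
  ⟨t, ρ', ω', he, ht.trans hT, hQ _ hq⟩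

theorem Reaches.seq (h : Reaches O p ρ T₁ Q) (h' : ∀ ρ', Q ρ' → Reaches O q ρ' T₂ Q')
    (hT : T₁ + T₂ ≤ T) : Reaches O (p.seq q) ρ T Q' := fun ω =>
  let ⟨t, ρ', ω', he, ht, hq⟩ := h ω
  let ⟨t', ρ'', ω'', he', ht', hq'⟩ := h' ρ' hq ω'
  ⟨t + t', ρ'', ω'', he.seq he', (Nat.add_le_add ht ht').trans hT, hq'⟩

theorem Reaches.ite {a : ℕ} (h : ρ a ≠ 0 → Reaches O p ρ T₁ Q)
    (h' : ρ a = 0 → Reaches O q ρ T₁ Q) (hT : 1 + T₁ ≤ T) : Reaches O (.ite a p q) ρ T Q := by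
  intro ω
  by_cases ha : ρ a = 0
  · obtain ⟨t, ρ', ω', he, ht, hq⟩ := h' ha ω
    exact ⟨1 + t, ρ', ω', Exec.ite_false ha he, (Nat.add_le_add le_rfl ht).trans hT, hq⟩
  · obtain ⟨t, ρ', ω', he, ht, hq⟩ := h ha ω
    exact ⟨1 + t, ρ', ω', Exec.ite_true ha he, (Nat.add_le_add le_rfl ht).trans hT, hq⟩

/-- The rule for a loop whose counter `a` goes down to zero. -/
theorem Reaches.loop {a : ℕ} (I : ℕ → (ℕ → ℕ) → Prop) {N : ℕ} (ha : ∀ i ρ, I i ρ → ρ a = i)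
    (hstep : ∀ i < N, ∀ ρ, I (i + 1) ρ → Reaches O p ρ T₁ (I i)) (hρ : I N ρ)
    (hT : N * (T₁ + 1) + 1 ≤ T) : Reaches O (.loop a p) ρ T (I 0) := by
  suffices h : ∀ j ≤ N, ∀ ρ, I j ρ → Reaches O (.loop a p) ρ (j * (T₁ + 1) + 1) (I 0) from
    (h N le_rfl ρ hρ).mono hT fun _ => id
  intro j
  induction j with
  | zero => exact fun _ ρ h ω => ⟨1, ρ, ω, Exec.loop_done (ha _ _ h), by simp, h⟩
  | succ j ih =>
    intro hj ρ h ω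
    obtain ⟨t, ρ', ω', he, ht, hI⟩ := hstep j hj ρ h ω
    obtain ⟨t', ρ'', ω'', he', ht', hI'⟩ := ih (by omega) ρ' hI ω'
    exact ⟨1 + t + t', ρ'', ω'', Exec.loop_step (by simp [ha _ _ h]) he he', by
      rw [Nat.succ_mul]; omega, hI'⟩

end Machine

/-! ### The exhaustive search and its running time -/

section Distinguisher

variable {O : ℕ → Bool}

/-- `x := 2 ^ a`, with counter `k`; register `3` holds one and register `4` zero. -/
def powProg (x a k : ℕ) : Program :=
  .seq (.seq (.const x 1) (.add k a 4)) (.loop k (.seq (.sub k k 3) (.add x x x)))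

theorem reaches_powProg {x a k : ℕ} {ρ : ℕ → ℕ} {T : ℕ} (hx3 : x ≠ 3) (hx4 : x ≠ 4) (hxa : x ≠ a)
    (hxk : x ≠ k) (hk3 : k ≠ 3) (h3 : ρ 3 = 1) (h4 : ρ 4 = 0) (hT : 2 ^ ρ a ≤ T) :
    Reaches O (powProg x a k) ρ (10 * (T + 1) ^ 2) fun ρ' =>
      ρ' x = 2 ^ ρ a ∧ ∀ r, r ≠ x → r ≠ k → ρ' r = ρ r := by
  have haT : ρ a ≤ T := Nat.lt_two_pow_self.le.trans hT
  refine Reaches.seq (Reaches.simple (Q := fun ρ' => ρ' k = ρ a ∧ ρ' x = 1 ∧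
    ∀ r, r ≠ x → r ≠ k → ρ' r = ρ r) ⟨trivial, trivial⟩ (le_refl _) ?_) (T₂ := T * (3 * T + 4) + 1)
    (fun ρ₁ h₁ => ?_) ?_
  · refine ⟨?_, ?_, fun r hrx hrk => ?_⟩ <;>
      simp [Program.effect, hx4.symm, hxa.symm, *]
  · refine (Reaches.loop (fun i ρ' => ρ' k = i ∧ i ≤ ρ a ∧ ρ' x = 2 ^ (ρ a - i) ∧
      ∀ r, r ≠ x → r ≠ k → ρ' r = ρ r) (N := ρ a) (T₁ := 3 * T + 3) (fun _ _ h => h.1)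
      ?_ ?_ ?_).mono le_rfl ?_
    · rintro i - ρ' ⟨hk, hi, hx, hr⟩
      have h3' := hr 3 hx3.symm hk3.symm
      have hp : 2 ^ (ρ a - (i + 1)) ≤ T := (Nat.pow_le_pow_right two_pos (by omega)).trans hT
      refine Reaches.simple ⟨trivial, trivial⟩ ?_ ⟨?_, by omega, ?_, fun r hrx hrk => ?_⟩
      · simp [Program.effect, Program.cost, hxk, hk, h3', h3, hx]
        omega
      · simp [Program.effect, Function.update_apply, hxk.symm, hk, h3', h3]
      · simp only [Program.effect, Function.update_self, ne_eq, hxk, not_false_eq_true,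
          Function.update_of_ne, hx]
        rw [← two_mul, ← pow_succ']
        congr 1
        omega
      · simp [Program.effect, Function.update_apply, hrx, hrk, hr r hrx hrk]
    · exact ⟨h₁.1, le_rfl, by simpa using h₁.2.1, h₁.2.2⟩
    · have := Nat.mul_le_mul_right (3 * T + 4) haT
      simpa using this
    · rintro ρ' ⟨-, -, h, h'⟩
      exact ⟨by simpa using h, h'⟩
  · simp only [Program.cost, Program.effect, Function.update_apply, hxa.symm, hx4.symm, if_false, h4]
    nlinarith

/-- `x := a * b`, with counter `k`; register `3` holds one and register `4` zero. -/
def mulProg (x a b k : ℕ) : Program :=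
  .seq (.seq (.const x 0) (.add k a 4)) (.loop k (.seq (.sub k k 3) (.add x x b)))

theorem reaches_mulProg {x a b k : ℕ} {ρ : ℕ → ℕ} {T : ℕ} (hx3 : x ≠ 3) (hx4 : x ≠ 4) (hxa : x ≠ a)
    (hxb : x ≠ b) (hkb : k ≠ b) (hxk : x ≠ k) (hk3 : k ≠ 3) (h3 : ρ 3 = 1) (h4 : ρ 4 = 0)
    (ha : ρ a ≤ T) (hb : ρ b ≤ T) :
    Reaches O (mulProg x a b k) ρ (10 * (T + 1) ^ 3) fun ρ' =>
      ρ' x = ρ a * ρ b ∧ ∀ r, r ≠ x → r ≠ k → ρ' r = ρ r := by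
  refine Reaches.seq (Reaches.simple (Q := fun ρ' => ρ' k = ρ a ∧ ρ' x = 0 ∧
    ∀ r, r ≠ x → r ≠ k → ρ' r = ρ r) ⟨trivial, trivial⟩ (le_refl _) ?_)
    (T₂ := T * (T * T + 2 * T + 4) + 1) (fun ρ₁ h₁ => ?_) ?_
  · refine ⟨?_, ?_, fun r hrx hrk => ?_⟩ <;>
      simp [Program.effect, hx4.symm, hxa.symm, *]
  -- The part of the product still to be added appears as a summand, which avoids truncated
  -- subtraction.
  · refine (Reaches.loop (fun i ρ' => ρ' k = i ∧ i ≤ ρ a ∧ ρ' x + i * ρ b = ρ a * ρ b ∧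
      ∀ r, r ≠ x → r ≠ k → ρ' r = ρ r) (N := ρ a) (T₁ := T * T + 2 * T + 3) (fun _ _ h => h.1)
      ?_ ?_ ?_).mono le_rfl ?_
    · rintro i - ρ' ⟨hk, hi, hx, hr⟩
      have h3' := hr 3 hx3.symm hk3.symm
      have hb' := hr b hxb.symm hkb.symm
      have hp : ρ a * ρ b ≤ T * T := Nat.mul_le_mul ha hb
      rw [Nat.succ_mul] at hx
      refine Reaches.simple ⟨trivial, trivial⟩ ?_ ⟨?_, by omega, ?_, fun r hrx hrk => ?_⟩
      · simp [Program.effect, Program.cost, hxk, hkb.symm, hk, h3', h3, hb']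
        omega
      · simp [Program.effect, Function.update_apply, hxk.symm, hk, h3', h3]
      · simp only [Program.effect, Function.update_self, ne_eq, hxk, hkb.symm, not_false_eq_true,
          Function.update_of_ne, hb']
        omega
      · simp [Program.effect, Function.update_apply, hrx, hrk, hr r hrx hrk]
    · exact ⟨h₁.1, le_rfl, by simp [h₁.2.1], h₁.2.2⟩
    · have := Nat.mul_le_mul_right (T * T + 2 * T + 4) ha
      simpa using this
    · rintro ρ' ⟨-, -, h, h'⟩
      exact ⟨by simpa using h, h'⟩
  · simp only [Program.cost, Program.effect, Function.update_apply, hxa.symm, hx4.symm, if_false, h4]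
    nlinarith [Nat.zero_le (T * T)]

/-- The number of positions among the `k` lowest at which `z` and `y` both have a binary digit
one. -/
def andCount : ℕ → ℕ → ℕ → ℕ
  | 0, _, _ => 0
  | k + 1, z, y => (z % 2 + y % 2) / 2 + andCount k (z / 2) (y / 2)

theorem andCount_le (k z y : ℕ) : andCount k z y ≤ k := by
  induction k generalizing z y with
  | zero => simp [andCount]
  | succ k ih =>
    have := ih (z / 2) (y / 2)
    simp only [andCount]
    omega

theorem andCount_eq_sum (k z y : ℕ) :
    andCount k z y = ∑ i : Fin k, (z.testBit i && y.testBit i).toNat := by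
  induction k generalizing z y with
  | zero => simp [andCount]
  | succ k ih =>
    rw [andCount, ih, Fin.sum_univ_succ]
    congr 1
    -- Half the sum of two bits, rounded down, is their conjunction.
    · rcases Nat.mod_two_eq_zero_or_one z with hz | hz <;>
        rcases Nat.mod_two_eq_zero_or_one y with hy | hy <;> simp [Nat.testBit_zero, hz, hy]
    · simp [Nat.testBit_succ]

/-- Register `15` receives the number of common digits of registers `11` and `12`. -/
def dotProg : Program :=
  .seq (.seq (.const 15 0) (.seq (.add 16 11 4) (.seq (.add 17 12 4) (.add 18 2 4))))
    (.loop 18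
      (.seq (.sub 18 18 3) <| .seq (.half 19 16) <| .seq (.half 20 17) <| .seq (.sub 16 16 19) <|
        .seq (.sub 16 16 19) <| .seq (.sub 17 17 20) <| .seq (.sub 17 17 20) <|
        .seq (.add 21 16 17) <| .seq (.half 21 21) <| .seq (.add 15 15 21) <|
        .seq (.add 16 19 4) (.add 17 20 4)))

/-- Each round isolates the lowest digits by subtracting the rounded half twice, then shifts both
numbers; the count so far plus the count over the remaining digits is invariant. -/
theorem reaches_dotProg {ρ : ℕ → ℕ} {T : ℕ} (h3 : ρ 3 = 1) (h4 : ρ 4 = 0) (h2 : ρ 2 ≤ T)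
    (hz : ρ 11 ≤ T) (hy : ρ 12 ≤ T) :
    Reaches O dotProg ρ (50 * (T + 1) ^ 2) fun ρ' =>
      ρ' 15 = andCount (ρ 2) (ρ 11) (ρ 12) ∧ ∀ r < 15, ρ' r = ρ r := by
  refine Reaches.seq (Reaches.simple (Q := fun ρ' => ρ' 18 = ρ 2 ∧ ρ' 15 = 0 ∧ ρ' 16 = ρ 11 ∧
    ρ' 17 = ρ 12 ∧ ∀ r < 15, ρ' r = ρ r) (by simp [Program.IsSimple]) (le_refl _) ?_)
    (T₂ := T * (30 * T + 31) + 1) (fun ρ₁ h₁ => ?_) ?_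
  · refine ⟨?_, ?_, ?_, ?_, fun r hr =>
      Program.WritesFrom.effect_eq hr (by simp [Program.WritesFrom])⟩ <;>
      simp [Program.effect, h4]
  · refine (Reaches.loop (fun i ρ' => ρ' 18 = i ∧ ρ' 16 ≤ T ∧ ρ' 17 ≤ T ∧
      ρ' 15 + andCount i (ρ' 16) (ρ' 17) = andCount (ρ 2) (ρ 11) (ρ 12) ∧
      ∀ r < 15, ρ' r = ρ r) (N := ρ 2) (T₁ := 30 * T + 30) (fun _ _ h => h.1)
      ?_ ?_ ?_).mono le_rfl ?_
    · rintro i hi ρ' ⟨hk, hz', hy', hx, hr⟩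
      have h3' := hr 3 (by omega)
      have h4' := hr 4 (by omega)
      have hp := andCount_le (ρ 2) (ρ 11) (ρ 12)
      refine Reaches.simple (by simp [Program.IsSimple]) ?_ ⟨?_, ?_, ?_, ?_, fun r hr' => ?_⟩
      · simp [Program.effect, Program.cost, h3', h3, h4', h4, hk]
        omega
      · simp [Program.effect, h3', h3, hk]
      · simp [Program.effect, h4', h4]
        omega
      · simp [Program.effect, h4', h4]
        omega
      · rw [← hx, andCount]
        simp only [Program.effect, Function.update_apply]
        norm_num [h4', h4]
        omega
      · rw [Program.WritesFrom.effect_eq hr' (by simp [Program.WritesFrom]), hr r hr']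
    · exact ⟨h₁.1, by omega, by omega, by simp [h₁.2.1, h₁.2.2.1, h₁.2.2.2.1], h₁.2.2.2.2⟩
    · have := Nat.mul_le_mul_right (30 * T + 31) h2
      simpa using this
    · rintro ρ' ⟨-, -, -, h, h'⟩
      exact ⟨by simpa [andCount] using h, h'⟩
  · simp [Program.cost, Program.effect, h4]
    nlinarith

/-- The registers that are set up at the start of the distinguisher. -/
structure IsSetUp (m n : ℕ) (ρ : ℕ → ℕ) : Prop where
  r2 : ρ 2 = n
  r3 : ρ 3 = 1
  r4 : ρ 4 = 0
  r5 : ρ 5 = 2 ^ m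
  r6 : ρ 6 = 2 ^ n
  r7 : ρ 7 = 2 ^ m * 2 ^ n
  r8 : ρ 8 = 4 * (2 ^ n * (m + n))

/-- Register `0` is exempt because it is the output flag, which the search may set. -/
theorem IsSetUp.congr {m n : ℕ} {ρ ρ' : ℕ → ℕ} (h : IsSetUp m n ρ)
    (hr : ∀ r < 9, r ≠ 0 → ρ' r = ρ r) : IsSetUp m n ρ' := by
  constructor <;> rw [hr _ (by norm_num) (by norm_num)]
  exacts [h.r2, h.r3, h.r4, h.r5, h.r6, h.r7, h.r8]

/-- The number of `y < 2 ^ n` for which the sum of the oracle answers to `θ + 2 ^ m * y` and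
`θ' + 2 ^ m * y` and the inner product of `z` and `y` is odd. -/
def oddCount (O : ℕ → Bool) (m n θ θ' z : ℕ) : ℕ :=
  ∑ y ∈ Finset.range (2 ^ n),
    ((O (θ + 2 ^ m * y)).toNat + (O (θ' + 2 ^ m * y)).toNat + andCount n z y) % 2

theorem oddCount_le (m n θ θ' z : ℕ) : oddCount O m n θ θ' z ≤ 2 ^ n := by
  refine (Finset.sum_le_card_nsmul _ _ 1 fun y _ => ?_).trans (by simp)
  omega

/-- Adds to register `14` the parity of the digit sum for register `12`, for the oracle queries
`9 + 13` and `10 + 13`. -/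
def parityProg : Program :=
  .seq (.add 22 9 13) <| .seq (.query 22 22) <| .seq (.add 23 10 13) <| .seq (.query 23 23) <|
    .seq (.add 22 22 23) <| .seq (.add 22 22 15) <| .seq (.half 23 22) <|
    .seq (.sub 22 22 23) <| .seq (.sub 22 22 23) (.add 14 14 22)

/-- Register `14` receives the odd count for the registers `9`, `10`, `11`. -/
def countProg : Program :=
  .seq (.seq (.const 14 0) (.seq (.add 12 6 4) (.add 13 7 4)))
    (.loop 12 (.seq (.seq (.sub 12 12 3) (.sub 13 13 5)) (.seq dotProg parityProg)))

/-- While register `12` counts `y` down from `2 ^ n`, register `13` follows as `2 ^ m * y`, so that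
a query is formed by one addition. -/
theorem reaches_countProg {m n : ℕ} {ρ : ℕ → ℕ} {T : ℕ} (hT : T = 2 ^ m * 2 ^ n)
    (hρ : IsSetUp m n ρ) (h9 : ρ 9 ≤ T) (h10 : ρ 10 ≤ T) (h11 : ρ 11 ≤ T) :
    Reaches O countProg ρ (200 * (T + 1) ^ 3) fun ρ' =>
      ρ' 14 = oddCount O m n (ρ 9) (ρ 10) (ρ 11) ∧ ∀ r < 12, ρ' r = ρ r := by
  have hmT : 2 ^ m ≤ T := hT ▸ Nat.le_mul_of_pos_right _ (by positivity)
  have hnT : 2 ^ n ≤ T := hT ▸ Nat.le_mul_of_pos_left _ (by positivity)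
  have hnT' : n ≤ T := Nat.lt_two_pow_self.le.trans hnT
  refine Reaches.seq (Reaches.simple (Q := fun ρ' => ρ' 12 = 2 ^ n ∧ ρ' 14 = 0 ∧
    ρ' 13 = 2 ^ m * 2 ^ n ∧ ∀ r < 12, ρ' r = ρ r) (by simp [Program.IsSimple]) (le_refl _) ?_)
    (T₂ := T * (100 * (T + 1) ^ 2 + 1) + 1) (fun ρ₁ h₁ => ?_) ?_
  · refine ⟨?_, ?_, ?_, fun r hr =>
      Program.WritesFrom.effect_eq hr (by simp [Program.WritesFrom])⟩ <;>
      simp [Program.effect, hρ.r4, hρ.r6, hρ.r7]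
  · refine (Reaches.loop (fun i ρ' => ρ' 12 = i ∧ i ≤ 2 ^ n ∧ ρ' 13 = 2 ^ m * i ∧
      ρ' 14 + ∑ y ∈ Finset.range i, ((O (ρ 9 + 2 ^ m * y)).toNat +
        (O (ρ 10 + 2 ^ m * y)).toNat + andCount n (ρ 11) y) % 2 =
        oddCount O m n (ρ 9) (ρ 10) (ρ 11) ∧
      ∀ r < 12, ρ' r = ρ r) (N := 2 ^ n) (T₁ := 100 * (T + 1) ^ 2) (fun _ _ h => h.1)
      ?_ ?_ ?_).mono le_rfl ?_
    · rintro i - ρ₂ ⟨hk, hi, h13, hs, hr⟩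
      have hi13 : 2 ^ m * (i + 1) ≤ T := hT ▸ Nat.mul_le_mul_left _ hi
      refine Reaches.seq (Reaches.simple (Q := fun ρ' => ρ' 12 = i ∧ ρ' 13 = 2 ^ m * i ∧
        ρ' 14 = ρ₂ 14 ∧ ∀ r < 12, ρ' r = ρ r) (T := 4 * T + 10) (by simp [Program.IsSimple])
        ?_ ?_) (T₂ := 50 * (T + 1) ^ 2 + (20 * T + 20)) (fun ρ₃ h₃ => ?_) (by nlinarith)
      · have := hr 3 (by norm_num)
        have := hr 5 (by norm_num)
        have := hρ.r3
        have := hρ.r5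
        simp [Program.effect, Program.cost, *]
        omega
      · refine ⟨?_, ?_, ?_, fun r hr' => by
          rw [Program.WritesFrom.effect_eq hr' (by simp [Program.WritesFrom]), hr r hr']⟩ <;>
          simp [Program.effect, hk, h13, hr 3, hρ.r3, hr 5, hρ.r5, mul_add]
      obtain ⟨h12, h13, h14, hr₃⟩ := h₃
      refine Reaches.seq (reaches_dotProg (T := T) ?_ ?_ ?_ ?_ ?_) (fun ρ₄ h₄ => ?_) le_rfl
      · rw [hr₃ 3 (by norm_num), hρ.r3]
      · rw [hr₃ 4 (by norm_num), hρ.r4]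
      · rw [hr₃ 2 (by norm_num), hρ.r2]; omega
      · rw [hr₃ 11 (by norm_num)]; omega
      · rw [h12]; omega
      obtain ⟨h15, hr₄⟩ := h₄
      rw [hr₃ 2 (by norm_num), hρ.r2, hr₃ 11 (by norm_num), h12] at h15
      have hle := oddCount_le (O := O) m n (ρ 9) (ρ 10) (ρ 11)
      have hand := andCount_le n (ρ 11) i
      have e9 : ρ₄ 9 = ρ 9 := (hr₄ 9 (by norm_num)).trans (hr₃ 9 (by norm_num))
      have e10 : ρ₄ 10 = ρ 10 := (hr₄ 10 (by norm_num)).trans (hr₃ 10 (by norm_num))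
      have e12 : ρ₄ 12 = i := (hr₄ 12 (by norm_num)).trans h12
      have e13 : ρ₄ 13 = 2 ^ m * i := (hr₄ 13 (by norm_num)).trans h13
      have e14 : ρ₄ 14 = ρ₂ 14 := (hr₄ 14 (by norm_num)).trans h14
      rw [Finset.sum_range_succ] at hs
      have hb := fun b : Bool => Bool.toNat_le b
      have hb1 := hb (O (ρ 9 + 2 ^ m * i))
      have hb2 := hb (O (ρ 10 + 2 ^ m * i))
      rw [mul_add] at hi13
      refine Reaches.simple (by simp [parityProg, Program.IsSimple]) ?_ ⟨?_, by omega, ?_, ?_, ?_⟩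
      · simp [parityProg, Program.effect, Program.cost, e9, e10, e13, e14, h15]
        omega
      · simp [parityProg, Program.effect, e12]
      · simp [parityProg, Program.effect, e13]
      · rw [← hs]
        simp [parityProg, Program.effect, e9, e10, e13, e14, h15]
        omega
      · intro r hr'
        rw [Program.WritesFrom.effect_eq hr' (by simp [parityProg, Program.WritesFrom]),
          hr₄ r (by omega), hr₃ r hr']
    · exact ⟨h₁.1, le_rfl, h₁.2.2.1, by rw [h₁.2.1, zero_add, oddCount], h₁.2.2.2⟩
    · exact Nat.add_le_add_right (Nat.mul_le_mul_right _ hnT) 1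
    · rintro ρ' ⟨-, -, -, h, h'⟩
      exact ⟨by simpa using h, h'⟩
  · simp [Program.cost, Program.effect, hρ.r4, hρ.r6, hρ.r7, ← hT]
    nlinarith

/-- The odd count deviates from its mean so much that `(2 ^ n - 2 * c) ^ 2 > 4 * 2 ^ n * (m + n)`. -/
def IsDeviant (O : ℕ → Bool) (m n θ θ' z : ℕ) : Prop :=
  4 * (2 ^ n * (m + n)) < (2 ^ n - 2 * oddCount O m n θ θ' z + (2 * oddCount O m n θ θ' z - 2 ^ n)) *
    (2 ^ n - 2 * oddCount O m n θ θ' z + (2 * oddCount O m n θ θ' z - 2 ^ n))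

/-- Sets register `0` if the registers `9`, `10`, `11` hold a deviant triple. -/
def testProg : Program :=
  .seq countProg <| .seq
    (.seq (.add 24 14 14) <| .seq (.sub 25 6 24) <| .seq (.sub 26 24 6) (.add 25 25 26)) <|
    .seq (mulProg 26 25 25 27) <| .seq (.sub 26 26 8) (.ite 26 (.const 0 1) (.const 24 0))

theorem reaches_testProg {m n : ℕ} {ρ : ℕ → ℕ} {T : ℕ} (hT : T = 2 ^ m * 2 ^ n)
    (hρ : IsSetUp m n ρ) (h9 : ρ 9 ≤ T) (h10 : ρ 10 ≤ T) (h11 : ρ 11 ≤ T) :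
    Reaches O testProg ρ (400 * (T + 1) ^ 3) fun ρ' =>
      (ρ' 0 ≠ 0 ↔ ρ 0 ≠ 0 ∨ IsDeviant O m n (ρ 9) (ρ 10) (ρ 11)) ∧
        ∀ r < 12, r ≠ 0 → ρ' r = ρ r := by
  have hnT : 2 ^ n ≤ T := hT ▸ Nat.le_mul_of_pos_left _ (by positivity)
  have hmT : 2 ^ m ≤ T := hT ▸ Nat.le_mul_of_pos_right _ (by positivity)
  have hnT' : n ≤ T := Nat.lt_two_pow_self.le.trans hnT
  have hmT' : m ≤ T := Nat.lt_two_pow_self.le.trans hmT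
  refine Reaches.seq (reaches_countProg hT hρ h9 h10 h11) (T₂ := 200 * (T + 1) ^ 3)
    (fun ρ₁ h₁ => ?_) (by omega)
  obtain ⟨h14, hr₁⟩ := h₁
  have hle := oddCount_le (O := O) m n (ρ 9) (ρ 10) (ρ 11)
  have e6 : ρ₁ 6 = 2 ^ n := (hr₁ 6 (by norm_num)).trans hρ.r6
  rw [IsDeviant]
  generalize oddCount O m n (ρ 9) (ρ 10) (ρ 11) = c at h14 hle ⊢
  -- One of the two truncated differences vanishes, so their sum is the absolute value `|2 ^ n - 2 *
  -- c|`.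
  refine Reaches.seq (Reaches.simple
    (Q := fun ρ' => ρ' 25 = 2 ^ n - 2 * c + (2 * c - 2 ^ n) ∧ ∀ r < 12, ρ' r = ρ r)
    (T := 20 * (T + 1)) (by simp [Program.IsSimple]) ?_ ⟨?_, fun r hr => ?_⟩)
    (T₂ := 10 * (T + 1) ^ 3 + 20 * (T + 1) ^ 2)
    (fun ρ₂ h₂ => ?_) (by nlinarith)
  · simp [Program.effect, Program.cost, e6, h14]
    omega
  · simp [Program.effect, e6, h14, two_mul]
  · rw [Program.WritesFrom.effect_eq hr (by simp [Program.WritesFrom]), hr₁ r hr]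
  obtain ⟨h25, hr₂⟩ := h₂
  have h25' : ρ₂ 25 ≤ T := by omega
  refine Reaches.seq (reaches_mulProg (T := T) (by norm_num) (by norm_num) (by norm_num)
    (by norm_num) (by norm_num) (by norm_num) (by norm_num) ((hr₂ 3 (by norm_num)).trans hρ.r3)
    ((hr₂ 4 (by norm_num)).trans hρ.r4) h25' h25') (fun ρ₃ h₃ => ?_) le_rfl
  obtain ⟨h26, hr₃⟩ := h₃
  have hr₃' : ∀ r < 12, ρ₃ r = ρ r := fun r hr => (hr₃ r (by omega) (by omega)).trans (hr₂ r hr)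
  have e8 := (hr₃' 8 (by norm_num)).trans hρ.r8
  rw [← h25]
  have hsq : ρ₂ 25 * ρ₂ 25 ≤ T * T := Nat.mul_le_mul h25' h25'
  have hthr : 2 ^ n * (m + n) ≤ T * (2 * T) := Nat.mul_le_mul hnT (by omega)
  -- A truncated difference is nonzero exactly when the strict inequality holds, which makes it
  -- usable as a branch condition.
  have e26 : (ρ₃ 26 - ρ₃ 8 = 0) ↔ ¬ 4 * (2 ^ n * (m + n)) < ρ₂ 25 * ρ₂ 25 := by
    rw [h26, e8]; omega
  refine Reaches.seq (Reaches.simple (Q := fun ρ' => ρ' 26 = ρ₃ 26 - ρ₃ 8 ∧ ∀ r < 12, ρ' r = ρ r)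
    (T := 10 * (T + 1) ^ 2) trivial ?_ ⟨by simp [Program.effect], fun r hr => ?_⟩)
    (T₂ := 1 + 2) (fun ρ₄ h₄ => ?_) (by nlinarith)
  · simp only [Program.cost, h26, e8]
    nlinarith
  · rw [Program.WritesFrom.effect_eq hr (by simp [Program.WritesFrom]), hr₃' r hr]
  rw [← h₄.1] at e26
  -- The second branch only has to do nothing of consequence; it writes to a scratch register.
  refine Reaches.ite (T₁ := 2) (fun h => Reaches.simple trivial le_rfl ⟨?_, fun r hr hr0 => ?_⟩)
    (fun h => Reaches.simple trivial (by simp [Program.cost]) ⟨?_, fun r hr hr0 => ?_⟩) le_rfl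
  · simp [Program.effect, not_not.1 (mt e26.2 h)]
  · simp [Program.effect, hr0, h₄.2 r hr]
  · simp [Program.effect, e26.1 h, h₄.2]
  · rw [Program.WritesFrom.effect_eq hr (by simp [Program.WritesFrom]), h₄.2 r hr]

/-- Runs `p` for all values of register `a` below that of register `b`. -/
def forProg (a b : ℕ) (p : Program) : Program :=
  .seq (.add a b 4) (.loop a (.seq (.sub a a 3) p))

/-- Register `0` accumulates a disjunction over the iterations. The body may overwrite everything
above its counter `a` but, apart from the flag, nothing up to `a`; loops therefore nest if inner
counters have larger numbers. -/
theorem reaches_forProg {a b : ℕ} {p : Program} {ρ : ℕ → ℕ} {T T' : ℕ} (R : ℕ → Prop)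
    (ha : 4 < a) (h3 : ρ 3 = 1) (h4 : ρ 4 = 0) (hb : ρ b ≤ T)
    (hp : ∀ i < ρ b, ∀ ρ₁ : ℕ → ℕ, ρ₁ a = i → (∀ r < a, r ≠ 0 → ρ₁ r = ρ r) →
      Reaches O p ρ₁ T' fun ρ₂ =>
        (ρ₂ 0 ≠ 0 ↔ ρ₁ 0 ≠ 0 ∨ R i) ∧ ∀ r < a + 1, r ≠ 0 → ρ₂ r = ρ₁ r) :
    Reaches O (forProg a b p) ρ ((T + 1) * (T' + T + 10)) fun ρ' =>
      (ρ' 0 ≠ 0 ↔ ρ 0 ≠ 0 ∨ ∃ i < ρ b, R i) ∧ ∀ r < a, r ≠ 0 → ρ' r = ρ r := by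
  refine Reaches.seq (Reaches.simple (Q := fun ρ' => ρ' a = ρ b ∧ ∀ r < a, ρ' r = ρ r)
    trivial (le_refl _) ⟨by simp [Program.effect, h4], fun r hr =>
      Program.WritesFrom.effect_eq hr le_rfl⟩)
    (T₂ := T * (T' + T + 6) + 1) (fun ρ₁ h₁ => ?_) ?_
  -- Since the counter descends, the candidates still to be tried are those below `i`: the flag or a
  -- hit among them is invariant.
  · refine (Reaches.loop (fun i ρ' => ρ' a = i ∧ i ≤ ρ b ∧
      ((ρ' 0 ≠ 0 ∨ ∃ j < i, R j) ↔ ρ 0 ≠ 0 ∨ ∃ j < ρ b, R j) ∧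
      ∀ r < a, r ≠ 0 → ρ' r = ρ r) (N := ρ b) (T₁ := T' + T + 5) (fun _ _ h => h.1)
      ?_ ?_ ?_).mono le_rfl ?_
    · rintro i - ρ₂ ⟨hk, hi, hs, hr⟩
      have h3' := (hr 3 (by omega) (by norm_num)).trans h3
      refine Reaches.seq (Reaches.simple (Q := fun ρ' => ρ' a = i ∧ ∀ r < a, ρ' r = ρ₂ r)
        trivial (le_refl _) ⟨by simp [Program.effect, h3', hk], fun r hr =>
          Program.WritesFrom.effect_eq hr le_rfl⟩) (T₂ := T') (fun ρ₃ h₃ => ?_) ?_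
      · refine (hp i hi ρ₃ h₃.1 fun r hra hr0 => (h₃.2 r hra).trans (hr r hra hr0)).mono le_rfl
          fun ρ₄ h₄ => ⟨?_, by omega, ?_, fun r hra hr0 => ?_⟩
        · rw [h₄.2 a (by omega) (by omega), h₃.1]
        · rw [h₄.1, h₃.2 0 (by omega), ← hs, or_assoc, Nat.exists_lt_succ_right, or_comm (a := R i)]
        · rw [h₄.2 r (by omega) hr0, h₃.2 r hra, hr r hra hr0]
      · simp [Program.cost, hk, h3']
        omega
    · exact ⟨h₁.1, le_rfl, by rw [h₁.2 0 (by omega)], fun r hr _ => h₁.2 r hr⟩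
    · exact Nat.add_le_add_right (Nat.mul_le_mul_right _ hb) 1
    · rintro ρ' ⟨-, -, h, h'⟩
      exact ⟨by simpa using h, h'⟩
  · simp [Program.cost, h4]
    nlinarith

/-- The oracle has a deviant triple with distinct salts. -/
def HasDeviation (O : ℕ → Bool) (m n : ℕ) : Prop :=
  ∃ θ < 2 ^ m, ∃ θ' < 2 ^ m, θ ≠ θ' ∧ ∃ z < 2 ^ n, IsDeviant O m n θ θ' z

/-- Sets register `0` if there is a deviant triple. -/
def searchProg : Program :=
  forProg 9 5 <| forProg 10 5 <|
    .seq (.seq (.sub 28 9 10) <| .seq (.sub 29 10 9) (.add 28 28 29))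
      (.ite 28 (forProg 11 6 testProg) (.const 28 0))

/-- Each of the three nested loops multiplies the cubic cost of a test by a factor of order `T`,
whence the exponent six. -/
theorem reaches_searchProg {m n : ℕ} {ρ : ℕ → ℕ} {T : ℕ} (hT : T = 2 ^ m * 2 ^ n)
    (hρ : IsSetUp m n ρ) :
    Reaches O searchProg ρ (1000 * (T + 1) ^ 6) fun ρ' =>
      (ρ' 0 ≠ 0 ↔ ρ 0 ≠ 0 ∨ HasDeviation O m n) := by
  have hnT : 2 ^ n ≤ T := hT ▸ Nat.le_mul_of_pos_left _ (by positivity)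
  have hmT : 2 ^ m ≤ T := hT ▸ Nat.le_mul_of_pos_right _ (by positivity)
  have h1 : 1 ≤ T + 1 := by omega
  have hp3 : 1 ≤ (T + 1) ^ 3 := Nat.one_le_pow _ _ h1
  have hp2 : T ≤ (T + 1) ^ 3 := T.le_succ.trans (Nat.le_self_pow (by norm_num) _)
  rw [← hρ.r5] at hmT
  refine (reaches_forProg (T := T) (T' := 900 * (T + 1) ^ 5)
    (fun θ => ∃ θ' < 2 ^ m, θ ≠ θ' ∧ ∃ z < 2 ^ n, IsDeviant O m n θ θ' z)
    (by norm_num) hρ.r3 hρ.r4 hmT fun θ hθ ρ₁ hθ₁ hr₁ => ?_).mono ?_ ?_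
  · have hρ₁ := hρ.congr hr₁
    have hmT₁ : ρ₁ 5 ≤ T := by rwa [hr₁ 5 (by norm_num) (by norm_num)]
    refine (reaches_forProg (T := T) (T' := 600 * (T + 1) ^ 4)
      (fun θ' => θ ≠ θ' ∧ ∃ z < 2 ^ n, IsDeviant O m n θ θ' z)
      (by norm_num) hρ₁.r3 hρ₁.r4 hmT₁ fun θ' hθ' ρ₂ hθ'₂ hr₂ => ?_).mono ?_ ?_
    · have hρ₂ := hρ₁.congr fun r hr => hr₂ r (by omega)
      have e9 : ρ₂ 9 = θ := (hr₂ 9 (by norm_num) (by norm_num)).trans hθ₁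
      -- Register `28` receives `|θ - θ'|`. Equal salts have to be skipped: for them all signs at `z
      -- = 0` are positive, whatever the function.
      refine Reaches.seq (Reaches.simple (Q := fun ρ' =>
        (ρ' 28 = 0 ↔ θ = θ') ∧ ∀ r < 12, ρ' r = ρ₂ r) (T := 10 * (T + 1))
        (by simp [Program.IsSimple]) ?_ ⟨?_, fun r hr =>
          Program.WritesFrom.effect_eq hr (by simp [Program.WritesFrom])⟩)
        (T₂ := 1 + 500 * (T + 1) ^ 4) (fun ρ₃ h₃ => ?_) ?_
      · simp [Program.cost, Program.effect, e9, hθ'₂]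
        omega
      · simp [Program.effect, e9, hθ'₂]
        omega
      · have hρ₃ := hρ₂.congr fun r hr _ => h₃.2 r (by omega)
        refine Reaches.ite (T₁ := 500 * (T + 1) ^ 4) (fun hne => ?_) (fun heq => ?_) le_rfl
        · rw [← hρ₃.r6] at hnT
          refine (reaches_forProg (T := T) (T' := 400 * (T + 1) ^ 3)
            (fun z => IsDeviant O m n θ θ' z)
            (by norm_num) hρ₃.r3 hρ₃.r4 hnT fun z hz ρ₄ hz₄ hr₄ => ?_).mono ?_ ?_
          · have hρ₄ := hρ₃.congr fun r hr => hr₄ r (by omega)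
            have e9' : ρ₄ 9 = θ := by
              rw [hr₄ 9 (by norm_num) (by norm_num), h₃.2 9 (by norm_num), e9]
            have e10' : ρ₄ 10 = θ' := by
              rw [hr₄ 10 (by norm_num) (by norm_num), h₃.2 10 (by norm_num), hθ'₂]
            refine (reaches_testProg hT hρ₄ (by omega) (by omega) (by omega)).mono le_rfl ?_
            rw [e9', e10', hz₄]
            exact fun _ => id
          · nlinarith [Nat.mul_le_mul_left (T + 1) hp3, Nat.mul_le_mul_left (T + 1) hp2]
          · rintro ρ₄ ⟨h0, hr₄⟩
            refine ⟨?_, fun r hr hr0 => ?_⟩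
            · rw [h0, h₃.2 0 (by norm_num), hρ₃.r6]
              simp [show θ ≠ θ' from fun h => hne (h₃.1.2 h)]
            · rw [hr₄ r (by omega) hr0, h₃.2 r (by omega)]
        · refine Reaches.simple trivial ?_ ⟨?_, fun r hr hr0 => ?_⟩
          · simp only [Program.cost]
            nlinarith
          · simp [Program.effect, h₃.2, h₃.1.1 heq]
          · rw [Program.effect, Function.update_of_ne (by omega), h₃.2 r (by omega)]
      · nlinarith [Nat.mul_le_mul_left (T + 1) hp3, Nat.mul_le_mul_left (T + 1) hp2]
    · have hp4 : 1 ≤ (T + 1) ^ 4 := Nat.one_le_pow _ _ h1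
      have : T ≤ (T + 1) ^ 4 := T.le_succ.trans (Nat.le_self_pow (by norm_num) _)
      nlinarith [Nat.mul_le_mul_left (T + 1) hp4, Nat.mul_le_mul_left (T + 1) this]
    · rintro ρ₂ ⟨h0, hr₂⟩
      refine ⟨?_, hr₂⟩
      rw [h0, hρ₁.r5]
  · have hp5 : 1 ≤ (T + 1) ^ 5 := Nat.one_le_pow _ _ h1
    have : T ≤ (T + 1) ^ 5 := T.le_succ.trans (Nat.le_self_pow (by norm_num) _)
    nlinarith [Nat.mul_le_mul_left (T + 1) hp5, Nat.mul_le_mul_left (T + 1) this]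
  · rintro ρ₂ ⟨h0, -⟩
    rw [h0, hρ.r5, HasDeviation]

/-- Prepares the registers `0` to `8`. -/
def setupProg : Program :=
  .seq (.seq (.const 0 0) <| .seq (.const 3 1) (.const 4 0)) <|
    .seq (powProg 5 1 9) <| .seq (powProg 6 2 9) <| .seq (.add 10 1 2) <|
    .seq (powProg 7 10 9) <| .seq (mulProg 8 6 10 9) <| .seq (.add 8 8 8) (.add 8 8 8)

theorem reaches_setupProg {m n : ℕ} {ρ : ℕ → ℕ} {T : ℕ} (hT : T = 2 ^ m * 2 ^ n)
    (h1 : ρ 1 = m) (h2 : ρ 2 = n) :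
    Reaches O setupProg ρ (500 * (T + 1) ^ 3) fun ρ' => ρ' 0 = 0 ∧ IsSetUp m n ρ' := by
  have hnT : 2 ^ n ≤ T := hT ▸ Nat.le_mul_of_pos_left _ (by positivity)
  have hmT : 2 ^ m ≤ T := hT ▸ Nat.le_mul_of_pos_right _ (by positivity)
  have hnT' : n < T := Nat.lt_two_pow_self.trans_le hnT
  have hmT' : m < T := Nat.lt_two_pow_self.trans_le hmT
  have hmnT : m + n ≤ T := by rw [hT, ← pow_add]; exact Nat.lt_two_pow_self.le
  -- Register `0` starts with the security parameter, which need not be bounded in terms of `T`. It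
  -- is overwritten unread, so it does not enter the running time.
  refine Reaches.seq (Reaches.simple (Q := fun ρ' => ρ' 0 = 0 ∧ ρ' 1 = m ∧ ρ' 2 = n ∧
    ρ' 3 = 1 ∧ ρ' 4 = 0) (T := 10) (by simp [Program.IsSimple]) (by simp [Program.cost])
    (by simp [Program.effect, h1, h2])) (fun ρ₁ h₁ => ?_)
    (T₂ := 10 * (T + 1) ^ 2 + (10 * (T + 1) ^ 2 + (10 * (T + 1) + (10 * (T + 1) ^ 2 +
      (10 * (T + 1) ^ 3 + 20 * (T + 1) ^ 2))))) (by nlinarith)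
  obtain ⟨a0, a1, a2, a3, a4⟩ := h₁
  refine Reaches.seq (reaches_powProg (T := T) (by norm_num) (by norm_num) (by norm_num)
    (by norm_num) (by norm_num) a3 a4 (by rwa [a1])) (fun ρ₂ h₂ => ?_) le_rfl
  obtain ⟨b5, hr₂⟩ := h₂
  refine Reaches.seq (reaches_powProg (T := T) (by norm_num) (by norm_num) (by norm_num)
    (by norm_num) (by norm_num) (by simp [hr₂, a3]) (by simp [hr₂, a4])
    (by simpa [hr₂, a2] using hnT)) (fun ρ₃ h₃ => ?_) le_rfl
  obtain ⟨b6, hr₃⟩ := h₃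
  refine Reaches.seq (Reaches.simple (Q := fun ρ' => ρ' 10 = m + n ∧ ∀ r < 10, ρ' r = ρ₃ r)
    trivial ?_ ⟨?_, fun r hr => Program.WritesFrom.effect_eq hr le_rfl⟩) (fun ρ₄ h₄ => ?_) le_rfl
  · simp [Program.cost, hr₃, hr₂, a1, a2]
    omega
  · simp [Program.effect, hr₃, hr₂, a1, a2]
  obtain ⟨b10, hr₄⟩ := h₄
  refine Reaches.seq (reaches_powProg (T := T) (by norm_num) (by norm_num) (by norm_num)
    (by norm_num) (by norm_num) (by simp [hr₄, hr₃, hr₂, a3]) (by simp [hr₄, hr₃, hr₂, a4])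
    (by rw [b10, pow_add, hT])) (fun ρ₅ h₅ => ?_) le_rfl
  obtain ⟨b7, hr₅⟩ := h₅
  have c6 : ρ₅ 6 = 2 ^ n := by simp [hr₅, hr₄, b6, hr₂, a2]
  have c10 : ρ₅ 10 = m + n := by simp [hr₅, b10]
  refine Reaches.seq (reaches_mulProg (T := T) (by norm_num) (by norm_num) (by norm_num)
    (by norm_num) (by norm_num) (by norm_num) (by norm_num) (by simp [hr₅, hr₄, hr₃, hr₂, a3])
    (by simp [hr₅, hr₄, hr₃, hr₂, a4]) (by rwa [c6]) (by rwa [c10])) (fun ρ₆ h₆ => ?_) le_rfl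
  obtain ⟨b8, hr₆⟩ := h₆
  rw [c6, c10] at b8
  have hthr : 2 ^ n * (m + n) ≤ T * T := Nat.mul_le_mul hnT hmnT
  refine Reaches.simple (by simp [Program.IsSimple]) ?_ ⟨?_, ?_⟩
  · simp [Program.cost, Program.effect, b8]
    nlinarith
  · simp [Program.effect, hr₆, hr₅, hr₄, hr₃, hr₂, a0]
  · constructor <;> simp [Program.effect, hr₆, hr₅, hr₄, hr₃, hr₂, a2, a3, a4, b5, a1, b6, b7, b8,
      b10, pow_add]
    omega

/-- The distinguisher searches exhaustively for a deviant triple. -/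
def distinguisher : Program := .seq setupProg searchProg

theorem reaches_distinguisher {m n : ℕ} {ρ : ℕ → ℕ} (h1 : ρ 1 = m) (h2 : ρ 2 = n) :
    Reaches O distinguisher ρ (1500 * (2 ^ (m + n) + 1) ^ 6) fun ρ' =>
      (ρ' 0 ≠ 0 ↔ HasDeviation O m n) := by
  rw [pow_add]
  refine Reaches.seq (reaches_setupProg rfl h1 h2) (fun ρ₁ h₁ =>
    (reaches_searchProg rfl h₁.2).mono le_rfl fun ρ' h => ?_) ?_
  · simpa [h₁.1] using h
  · have := Nat.pow_le_pow_right (n := 2 ^ m * 2 ^ n + 1) (by positivity) (show 3 ≤ 6 by norm_num)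
    omega

end Distinguisher

/-! ### An operator bound for commuting measurements -/

section Monogamy

open ContinuousLinearMap

theorem clm_mul_apply {H : Type*} [NormedAddCommGroup H] [InnerProductSpace ℂ H] (A B : H →L[ℂ] H)
    (v : H) : (A * B) v = A (B v) := rfl

variable {H : Type*} [NormedAddCommGroup H] [InnerProductSpace ℂ H] [CompleteSpace H]
  {Θ X : Type*} [Fintype X]

theorem clm_inner_left (A : H →L[ℂ] H) (v w : H) : inner ℂ (A v) w = inner ℂ v (star A w) := by
  rw [star_eq_adjoint, adjoint_inner_right]

theorem sum_norm_sq_apply_eq {R : X → H →L[ℂ] H} (hR : ∑ x, star (R x) * R x = 1) (w : H) :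
    ∑ x, ‖R x w‖ ^ 2 = ‖w‖ ^ 2 := by
  have h := congrArg (fun M : H →L[ℂ] H => inner ℂ w (M w)) hR
  simp only [sum_apply, inner_sum, clm_mul_apply, star_eq_adjoint, adjoint_inner_right] at h
  rw [show (1 : H →L[ℂ] H) w = w from rfl] at h
  simp only [inner_self_eq_norm_sq_to_K] at h
  exact_mod_cast h

theorem norm_le_one_of_sum_star_mul_self_eq_one {R : X → H →L[ℂ] H}
    (hR : ∑ x, star (R x) * R x = 1) (x : X) : ‖R x‖ ≤ 1 := by
  refine opNorm_le_bound _ zero_le_one fun w => ?_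
  rw [one_mul, ← sq_le_sq₀ (norm_nonneg _) (norm_nonneg _), ← sum_norm_sq_apply_eq hR w]
  exact Finset.single_le_sum (f := fun x => ‖R x w‖ ^ 2) (fun _ _ => sq_nonneg _)
    (Finset.mem_univ x)

/-- For every question, three measurements that commute with each other and across questions:
projections `a`, and `star R * R`, `star S * S`. -/
structure IsCommutingFamily (a R S : Θ → X → H →L[ℂ] H) : Prop where
  proj : ∀ θ x, IsStarProjection (a θ x)
  sum_R : ∀ θ, ∑ x, star (R θ x) * R θ x = 1
  sum_S : ∀ θ, ∑ x, star (S θ x) * S θ x = 1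
  aR : ∀ θ θ' x y, Commute (a θ x) (R θ' y)
  aS : ∀ θ θ' x y, Commute (a θ x) (S θ' y)
  RS : ∀ θ θ' x y, Commute (R θ x) (S θ' y)
  RS' : ∀ θ θ' x y, Commute (R θ x) (star (S θ' y))

/-- The operator of winning the game at question `θ`. -/
noncomputable def winOp (a R S : Θ → X → H →L[ℂ] H) (θ : Θ) : H →L[ℂ] H :=
  ∑ x, a θ x * (star (R θ x) * R θ x * (star (S θ x) * S θ x))

variable {a R S : Θ → X → H →L[ℂ] H}

namespace IsCommutingFamily

theorem aR' (h : IsCommutingFamily a R S) (θ θ' : Θ) (x y : X) :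
    Commute (a θ x) (star (R θ' y)) := by
  have := (h.aR θ θ' x y).star_star
  rwa [(h.proj θ x).isSelfAdjoint.star_eq] at this

theorem aS' (h : IsCommutingFamily a R S) (θ θ' : Θ) (x y : X) :
    Commute (a θ x) (star (S θ' y)) := by
  have := (h.aS θ θ' x y).star_star
  rwa [(h.proj θ x).isSelfAdjoint.star_eq] at this

/-- Doubling the projection `a` and commuting the factors exhibits the summand as `star M * M` with
`M = a * R * S`. -/
theorem summand_eq (h : IsCommutingFamily a R S) (θ : Θ) (x : X) :
    a θ x * (star (R θ x) * R θ x * (star (S θ x) * S θ x)) =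
      star (R θ x) * star (S θ x) * a θ x * (a θ x * R θ x * S θ x) := by
  have h1 := (h.aR' θ θ x x).eq
  have h2 := (h.aS' θ θ x x).eq
  have h3 := (h.RS' θ θ x x).eq
  have h4 : a θ x * a θ x = a θ x := (h.proj θ x).isIdempotentElem
  calc _ = (a θ x * star (R θ x)) * (R θ x * star (S θ x)) * S θ x := by simp only [mul_assoc]
    _ = star (R θ x) * (a θ x * star (S θ x)) * (R θ x * S θ x) := by
      rw [h1, h3]; simp only [mul_assoc]
    _ = star (R θ x) * star (S θ x) * (a θ x * a θ x) * (R θ x * S θ x) := by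
      rw [h2, h4]; simp only [mul_assoc]
    _ = _ := by simp only [mul_assoc]

theorem inner_winOp (h : IsCommutingFamily a R S) (θ : Θ) (v : H) :
    inner ℂ v (winOp a R S θ v) = ((∑ x, ‖(a θ x * R θ x * S θ x) v‖ ^ 2 : ℝ) : ℂ) := by
  rw [winOp, sum_apply, inner_sum, Complex.ofReal_sum]
  refine Finset.sum_congr rfl fun x _ => ?_
  rw [h.summand_eq]
  have : star (R θ x) * star (S θ x) * a θ x = star (a θ x * R θ x * S θ x) := by
    rw [star_mul, star_mul, (h.proj θ x).isSelfAdjoint.star_eq, ← mul_assoc,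
      (h.RS θ θ x x).star_star.eq]
  rw [this, clm_mul_apply, ← clm_inner_left, inner_self_eq_norm_sq_to_K, Complex.ofReal_pow]
  rfl

/-- Operators of different parties commute, so Bob's factors can all be moved onto `p` and Charlie's
onto `q`, leaving only Alice's product `a θ x * a θ' y`, whose norm is the overlap, in between. -/
theorem inner_summand_eq (h : IsCommutingFamily a R S) (θ θ' : Θ) (x y : X) (p q : H) :
    inner ℂ ((star (R θ x) * star (S θ x) * a θ x) p) ((star (R θ' y) * star (S θ' y) * a θ' y) q) =
      inner ℂ ((R θ' y * star (R θ x)) p) ((a θ x * a θ' y) ((S θ x * star (S θ' y)) q)) := by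
  have e : star (star (R θ x) * star (S θ x) * a θ x) * (star (R θ' y) * star (S θ' y) * a θ' y) =
      star (R θ' y * star (R θ x)) * (a θ x * a θ' y * (S θ x * star (S θ' y))) := by
    have hs := (h.proj θ x).isSelfAdjoint.star_eq
    have h1 := (h.aS θ θ x x).eq
    have h2 := (h.aR θ θ x x).eq
    have h3 := (h.aR' θ θ' x y).eq
    have h4 := (h.RS' θ' θ y x).star_star.eq
    rw [star_star] at h4
    have h5 := (h.RS θ θ x x).eq
    have h6 := (h.aS θ' θ y x).eq
    have h7 := (h.aS' θ' θ' y y).eq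
    calc _ = a θ x * (S θ x * R θ x) * (star (R θ' y) * star (S θ' y) * a θ' y) := by
          simp only [star_mul, star_star, hs]
      _ = (a θ x * R θ x) * (S θ x * star (R θ' y)) * (star (S θ' y) * a θ' y) := by
          rw [← h5]; simp only [mul_assoc]
      _ = R θ x * (a θ x * star (R θ' y)) * (S θ x * (star (S θ' y) * a θ' y)) := by
          rw [h2, ← h4]; simp only [mul_assoc]
      _ = R θ x * star (R θ' y) * (a θ x * (S θ x * a θ' y) * star (S θ' y)) := by
          rw [h3, ← h7]; simp only [mul_assoc]
      _ = _ := by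
          rw [← h6]; simp only [star_mul, star_star, mul_assoc]
  calc _ = inner ℂ p ((star (star (R θ x) * star (S θ x) * a θ x) *
        (star (R θ' y) * star (S θ' y) * a θ' y)) q) := by
        rw [clm_inner_left, ← clm_mul_apply]
    _ = _ := by
        rw [e, clm_mul_apply, ← clm_inner_left]
        rfl

/-- The double sum over answers costs no factor `|X|`: after the separation of Bob from Charlie,
Bob's completeness relation for `θ'` absorbs the sum over `y`, and Charlie's for `θ` the sum over
`x`. -/
theorem norm_inner_winOp_le (h : IsCommutingFamily a R S) {θ θ' : Θ} {c : ℝ} (hc0 : 0 ≤ c)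
    (hc : ∀ x y, ‖a θ x * a θ' y‖ ≤ c) (v : H) :
    ‖inner ℂ (winOp a R S θ v) (winOp a R S θ' v)‖ ≤
      c * ((∑ x, ‖(a θ x * R θ x * S θ x) v‖ ^ 2 + ∑ x, ‖(a θ' x * R θ' x * S θ' x) v‖ ^ 2) / 2) := by
  set p := fun x => (a θ x * R θ x * S θ x) v
  set q := fun x => (a θ' x * R θ' x * S θ' x) v
  have h1 : ∀ x, ∑ y, ‖(R θ' y * star (R θ x)) (p x)‖ ^ 2 ≤ ‖p x‖ ^ 2 := fun x => by
    simp only [clm_mul_apply]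
    rw [sum_norm_sq_apply_eq (h.sum_R θ')]
    refine pow_le_pow_left₀ (norm_nonneg _) ?_ 2
    refine (le_opNorm _ _).trans (mul_le_of_le_one_left (norm_nonneg _) ?_)
    rw [norm_star]
    exact norm_le_one_of_sum_star_mul_self_eq_one (h.sum_R θ) x
  have h2 : ∀ y, ∑ x, ‖(S θ x * star (S θ' y)) (q y)‖ ^ 2 ≤ ‖q y‖ ^ 2 := fun y => by
    simp only [clm_mul_apply]
    rw [sum_norm_sq_apply_eq (h.sum_S θ)]
    refine pow_le_pow_left₀ (norm_nonneg _) ?_ 2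
    refine (le_opNorm _ _).trans (mul_le_of_le_one_left (norm_nonneg _) ?_)
    rw [norm_star]
    exact norm_le_one_of_sum_star_mul_self_eq_one (h.sum_S θ') y
  have h3 : ∀ x y, ‖inner ℂ ((R θ' y * star (R θ x)) (p x))
      ((a θ x * a θ' y) ((S θ x * star (S θ' y)) (q y)))‖ ≤
      c * ((‖(R θ' y * star (R θ x)) (p x)‖ ^ 2 + ‖(S θ x * star (S θ' y)) (q y)‖ ^ 2) / 2) := by
    intro x y
    refine (norm_inner_le_norm _ _).trans ?_
    have := (le_opNorm (a θ x * a θ' y) ((S θ x * star (S θ' y)) (q y))).trans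
      (mul_le_mul_of_nonneg_right (hc x y) (norm_nonneg _))
    refine (mul_le_mul_of_nonneg_left this (norm_nonneg _)).trans ?_
    rw [mul_left_comm]
    refine mul_le_mul_of_nonneg_left ?_ hc0
    linarith [two_mul_le_add_sq ‖(R θ' y * star (R θ x)) (p x)‖ ‖(S θ x * star (S θ' y)) (q y)‖]
  have e : inner ℂ (winOp a R S θ v) (winOp a R S θ' v) = ∑ x, ∑ y,
      inner ℂ ((R θ' y * star (R θ x)) (p x))
        ((a θ x * a θ' y) ((S θ x * star (S θ' y)) (q y))) := by
    rw [winOp, winOp, sum_apply, sum_apply, sum_inner]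
    refine Finset.sum_congr rfl fun x _ => ?_
    rw [inner_sum]
    refine Finset.sum_congr rfl fun y _ => ?_
    rw [h.summand_eq, h.summand_eq]
    exact h.inner_summand_eq θ θ' x y (p x) (q y)
  rw [e]
  refine (norm_sum_le _ _).trans ((Finset.sum_le_sum fun x _ => (norm_sum_le _ _).trans
    (Finset.sum_le_sum fun y _ => h3 x y)).trans ?_)
  simp only [← Finset.mul_sum, ← Finset.sum_div, Finset.sum_add_distrib]
  refine mul_le_mul_of_nonneg_left (div_le_div_of_nonneg_right (add_le_add
    (Finset.sum_le_sum fun x _ => h1 x) ?_) zero_le_two) hc0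
  rw [Finset.sum_comm]
  exact Finset.sum_le_sum fun y _ => h2 y

theorem sum_re_inner_winOp_le [Fintype Θ] [DecidableEq Θ] (h : IsCommutingFamily a R S) {c : ℝ} (hc0 : 0 ≤ c)
    (hc : ∀ θ θ', θ ≠ θ' → ∀ x y, ‖a θ x * a θ' y‖ ≤ c) (v : H) :
    ∑ θ, (inner ℂ v (winOp a R S θ v)).re ≤ (1 + Fintype.card Θ * c) * ‖v‖ ^ 2 := by
  set s : Θ → ℝ := fun θ => ∑ x, ‖(a θ x * R θ x * S θ x) v‖ ^ 2
  have hs : ∀ θ, (inner ℂ v (winOp a R S θ v)).re = s θ := fun θ => by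
    rw [h.inner_winOp, Complex.ofReal_re]
  have hs0 : ∀ θ, 0 ≤ s θ := fun θ => Finset.sum_nonneg fun _ _ => sq_nonneg _
  -- On the diagonal the trivial bound `1` on the overlap is used; it produces the summand `1` of
  -- `κ`.
  have hpair : ∀ θ θ', ‖inner ℂ (winOp a R S θ v) (winOp a R S θ' v)‖ ≤
      ((if θ = θ' then 1 else 0) + c) * ((s θ + s θ') / 2) := by
    intro θ θ'
    have hnn : 0 ≤ (s θ + s θ') / 2 := by linarith [hs0 θ, hs0 θ']
    split_ifs with heq
    · refine (h.norm_inner_winOp_le zero_le_one (fun x y => ?_) v).trans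
        (mul_le_mul_of_nonneg_right (by linarith) hnn)
      refine (norm_mul_le _ _).trans (mul_le_one₀ ?_ (norm_nonneg _) ?_)
      · exact (h.proj θ x).norm_le
      · exact (h.proj θ' y).norm_le
    · rw [zero_add]
      exact h.norm_inner_winOp_le hc0 (hc θ θ' heq) v
  set κ : ℝ := 1 + Fintype.card Θ * c
  have hκ : 0 ≤ κ := by positivity
  have hsq : ‖∑ θ, winOp a R S θ v‖ ^ 2 ≤ κ * ∑ θ, s θ := by
    have e1 : ‖∑ θ, winOp a R S θ v‖ ^ 2 =
        ‖∑ θ, ∑ θ', inner ℂ (winOp a R S θ v) (winOp a R S θ' v)‖ := by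
      simp only [← inner_sum, ← sum_inner]
      rw [inner_self_eq_norm_sq_to_K]
      simp
    rw [e1]
    refine (norm_sum_le _ _).trans ((Finset.sum_le_sum fun θ _ => (norm_sum_le _ _).trans
      (Finset.sum_le_sum fun θ' _ => hpair θ θ')).trans_eq ?_)
    simp only [add_mul, Finset.sum_add_distrib, ite_mul, one_mul, zero_mul, Finset.sum_ite_eq,
      Finset.mem_univ, if_true, ← Finset.mul_sum, ← Finset.sum_div, Finset.sum_const,
      Finset.card_univ, nsmul_eq_mul, κ]
    ring
  simp only [hs]
  have hle : ∑ θ, s θ ≤ ‖v‖ * ‖∑ θ, winOp a R S θ v‖ := by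
    have : ∑ θ, s θ = (inner ℂ v (∑ θ, winOp a R S θ v)).re := by
      rw [inner_sum, Complex.re_sum]
      simp only [hs]
    rw [this]
    exact (Complex.re_le_norm _).trans (norm_inner_le_norm _ _)
  have hnn : 0 ≤ ∑ θ, s θ := Finset.sum_nonneg fun θ _ => hs0 θ
  -- With `Σ = ∑ s θ`, the two estimates give `Σ ^ 2 ≤ κ * ‖v‖ ^ 2 * Σ`, and one factor `Σ` is
  -- cancelled.
  rcases hnn.eq_or_lt with h0 | hpos
  · rw [← h0]; positivity
  · have h2 : (∑ θ, s θ) ^ 2 ≤ ‖v‖ ^ 2 * (κ * ∑ θ, s θ) := by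
      refine (pow_le_pow_left₀ hnn hle 2).trans ?_
      rw [mul_pow]
      exact mul_le_mul_of_nonneg_left hsq (sq_nonneg _)
    nlinarith

end IsCommutingFamily

end Monogamy

/-! ### From basis overlaps to the value of the game -/

section MonogamyValue

open Matrix

theorem norm_le_one_of_isStarProjection_star_mul_self {E : Type*} [NonUnitalNormedRing E]
    [StarRing E] [CStarRing E] {M : E} (h : IsStarProjection (star M * M)) : ‖M‖ ≤ 1 := by
  have := h.norm_le
  rw [CStarRing.norm_star_mul_self] at this
  nlinarith [norm_nonneg M]

open scoped MatrixOrder Matrix.Norms.L2Operator in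
theorem Matrix.PosSemidef.exists_eq_star_mul_self {I : Type*} [Fintype I] [DecidableEq I]
    {M : Matrix I I ℂ} (h : M.PosSemidef) : ∃ R : Matrix I I ℂ, M = star R * R :=
  CStarAlgebra.nonneg_iff_eq_star_mul_self.mp h.nonneg

/-- Bounds on the quadratic form of an operator bound its trace against density matrices. -/
theorem re_trace_mul_le {I : Type*} [Fintype I] [DecidableEq I] {M ρ : Matrix I I ℂ}
    (hρ : ρ.PosSemidef) (hρ1 : ρ.trace = 1) {κ : ℝ}
    (h : ∀ v : EuclideanSpace ℂ I,
      (inner ℂ v (toEuclideanCLM (𝕜 := ℂ) M v)).re ≤ κ * ‖v‖ ^ 2) :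
    (trace (M * ρ)).re ≤ κ := by
  obtain ⟨W, hW⟩ := hρ.exists_eq_star_mul_self
  -- The conjugated rows of `W` decompose `ρ` as `∑ j, |w j⟩⟨w j|`, with squared norms summing to
  -- the trace.
  set w : I → EuclideanSpace ℂ I := fun j => WithLp.toLp 2 fun i => star (W j i)
  have h1 : ∀ j, inner ℂ (w j) (toEuclideanCLM (𝕜 := ℂ) M (w j)) = (W * M * star W) j j := by
    intro j
    rw [EuclideanSpace.inner_eq_star_dotProduct, ofLp_toEuclideanCLM, dotProduct_comm]
    simp only [w, dotProduct, mulVec, mul_apply, Pi.star_apply, star_star, Finset.mul_sum,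
      Finset.sum_mul, star_apply, mul_assoc]
    rw [Finset.sum_comm]
  have h2 : ∀ j, ((‖w j‖ ^ 2 : ℝ) : ℂ) = (W * star W) j j := by
    intro j
    have := inner_self_eq_norm_sq_to_K (𝕜 := ℂ) (w j)
    rw [Complex.ofReal_pow]
    refine this.symm.trans ?_
    rw [EuclideanSpace.inner_eq_star_dotProduct, dotProduct_comm]
    simp only [w, dotProduct, mul_apply, Pi.star_apply, star_star, star_apply]
  have h3 : ∑ j, ‖w j‖ ^ 2 = 1 := by
    have : ((∑ j, ‖w j‖ ^ 2 : ℝ) : ℂ) = 1 := by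
      rw [Complex.ofReal_sum, ← hρ1, hW, trace_mul_comm]
      exact Finset.sum_congr rfl fun j _ => h2 j
    exact_mod_cast this
  calc (trace (M * ρ)).re = ∑ j, (inner ℂ (w j) (toEuclideanCLM (𝕜 := ℂ) M (w j))).re := by
        rw [hW, ← Matrix.mul_assoc, trace_mul_comm, ← Matrix.mul_assoc, ← Complex.re_sum]
        exact congrArg Complex.re (Finset.sum_congr rfl fun j _ => (h1 j).symm)
    _ ≤ ∑ j, κ * ‖w j‖ ^ 2 := Finset.sum_le_sum fun j _ => h _
    _ = κ := by rw [← Finset.mul_sum, h3, mul_one]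

variable {m n : ℕ}

/-- The matrix of overlaps between the measurement bases for two questions. -/
noncomputable def overlap (g : BitString (m + n) → Bool) (θ θ' : BitString m) :
    Matrix (BitString n) (BitString n) ℂ :=
  (saltedUnitary g θ)ᴴ * saltedUnitary g θ'

theorem conjTranspose_mul_saltedUnitary (g : BitString (m + n) → Bool) (θ : BitString m) :
    (saltedUnitary g θ)ᴴ * saltedUnitary g θ = 1 :=
  mul_eq_one_comm.1 (saltedUnitary_mul_conjTranspose g θ)

/-- Both projectors have rank one, so the product is the inner product of the two basis vectors
times a partial isometry. -/
theorem saltedProjector_mul_saltedProjector (g : BitString (m + n) → Bool) (θ θ' : BitString m)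
    (x y : BitString n) : saltedProjector g θ x * saltedProjector g θ' y =
      overlap g θ θ' x y • (saltedUnitary g θ * single x y 1 * (saltedUnitary g θ')ᴴ) := by
  have h : single x x (1 : ℂ) * overlap g θ θ' * single y y 1 = overlap g θ θ' x y • single x y 1 := by
    rw [single_mul_mul_single, one_mul, mul_one, smul_single, smul_eq_mul, mul_one]
  rw [← Matrix.smul_mul, ← Matrix.mul_smul, ← h]
  simp only [saltedProjector, overlap, Matrix.mul_assoc]

theorem saltedProjector_isStarProjection (g : BitString (m + n) → Bool) (θ : BitString m)
    (x : BitString n) : IsStarProjection (saltedProjector g θ x) where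
  isIdempotentElem := by
    rw [IsIdempotentElem, saltedProjector_mul_saltedProjector, overlap,
      conjTranspose_mul_saltedUnitary, one_apply_eq, one_smul, saltedProjector]
  isSelfAdjoint := ((saltedProjector_isPOVM g θ).posSemidef x).isHermitian

theorem star_kronecker_one {A E : Type*} [DecidableEq E] (M : Matrix A A ℂ) :
    star (M ⊗ₖ (1 : Matrix E E ℂ)) = star M ⊗ₖ (1 : Matrix E E ℂ) := by
  rw [star_eq_conjTranspose, conjTranspose_kronecker, conjTranspose_one, star_eq_conjTranspose]

theorem star_one_kronecker {A E : Type*} [DecidableEq E] (M : Matrix A A ℂ) :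
    star ((1 : Matrix E E ℂ) ⊗ₖ M) = (1 : Matrix E E ℂ) ⊗ₖ star M := by
  rw [star_eq_conjTranspose, conjTranspose_kronecker, conjTranspose_one, star_eq_conjTranspose]

theorem IsStarProjection.kronecker_one {A E : Type*} [Fintype A] [Fintype E] [DecidableEq E]
    {M : Matrix A A ℂ} (h : IsStarProjection M) :
    IsStarProjection (M ⊗ₖ (1 : Matrix E E ℂ)) where
  isIdempotentElem := by
    rw [IsIdempotentElem, ← mul_kronecker_mul, h.isIdempotentElem, Matrix.one_mul]
  isSelfAdjoint := by
    rw [IsSelfAdjoint, star_kronecker_one, h.isSelfAdjoint.star_eq]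

theorem sum_one_kronecker {A E X : Type*} [Fintype X] [DecidableEq E] (M : X → Matrix A A ℂ) :
    ∑ x, (1 : Matrix E E ℂ) ⊗ₖ M x = 1 ⊗ₖ ∑ x, M x := by
  ext i j
  simp [Matrix.sum_apply, Finset.mul_sum]

theorem sum_kronecker_one {A E X : Type*} [Fintype X] [DecidableEq E] (M : X → Matrix A A ℂ) :
    ∑ x, M x ⊗ₖ (1 : Matrix E E ℂ) = (∑ x, M x) ⊗ₖ 1 := by
  ext i j
  simp [Matrix.sum_apply, Finset.sum_mul]

/-- Small overlaps bound the winning probabilities. -/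
theorem winProb_saltedGame_le (g : BitString (m + n) → Bool) {c : ℝ} (hc0 : 0 ≤ c)
    (hc : ∀ θ θ', θ ≠ θ' → ∀ x y, ‖overlap g θ θ' x y‖ ≤ c)
    (T : QuantumStrategy (BitString n) (BitString m) (BitString n)) :
    (saltedGame g).winProb T ≤ (2 : ℝ) ^ (-(m : ℝ)) + c := by
  -- Factoring the measurement operators suffices; Bob's and Charlie's measurements need not be
  -- dilated to projective ones.
  choose R hR using fun θ x => ((T.bob_isPOVM θ).posSemidef x).exists_eq_star_mul_self
  choose S hS using fun θ x => ((T.charlie_isPOVM θ).posSemidef x).exists_eq_star_mul_self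
  let Φ : Matrix (BitString n × (Fin T.dB × Fin T.dC)) (BitString n × (Fin T.dB × Fin T.dC)) ℂ ≃⋆ₐ[ℂ]
      (EuclideanSpace ℂ (BitString n × (Fin T.dB × Fin T.dC)) →L[ℂ]
        EuclideanSpace ℂ (BitString n × (Fin T.dB × Fin T.dC))) := toEuclideanCLM (𝕜 := ℂ)
  let a := fun θ x => Φ (saltedProjector g θ x ⊗ₖ 1)
  let b := fun θ x => Φ (1 ⊗ₖ (R θ x ⊗ₖ 1))
  let d := fun θ x => Φ (1 ⊗ₖ (1 ⊗ₖ S θ x))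
  have hcomm : IsCommutingFamily a b d := by
    constructor
    · exact fun θ x => (saltedProjector_isStarProjection g θ x).kronecker_one.map Φ
    · intro θ
      simp only [b, ← map_star, ← map_mul, ← map_sum, star_one_kronecker, star_kronecker_one,
        ← mul_kronecker_mul, Matrix.one_mul, ← hR,
        sum_one_kronecker, sum_kronecker_one, (T.bob_isPOVM θ).sum_eq_one, one_kronecker_one, map_one]
    · intro θ
      simp only [d, ← map_star, ← map_mul, ← map_sum, star_one_kronecker,
        ← mul_kronecker_mul, Matrix.one_mul, ← hS,
        sum_one_kronecker, (T.charlie_isPOVM θ).sum_eq_one, one_kronecker_one, map_one]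
    · intro θ θ' x y
      simp only [a, b, Commute, SemiconjBy, ← map_mul, ← mul_kronecker_mul, Matrix.one_mul,
        Matrix.mul_one]
    · intro θ θ' x y
      simp only [a, d, Commute, SemiconjBy, ← map_mul, ← mul_kronecker_mul, Matrix.one_mul,
        Matrix.mul_one]
    · intro θ θ' x y
      simp only [b, d, Commute, SemiconjBy, ← map_mul, ← mul_kronecker_mul, Matrix.one_mul,
        Matrix.mul_one]
    · intro θ θ' x y
      simp only [b, d, Commute, SemiconjBy, ← map_star, ← map_mul, star_one_kronecker,
        ← mul_kronecker_mul, Matrix.one_mul, Matrix.mul_one]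
  have hoverlap : ∀ θ θ', θ ≠ θ' → ∀ x y, ‖a θ x * a θ' y‖ ≤ c := by
    intro θ θ' hne x y
    simp only [a, ← map_mul, ← mul_kronecker_mul, Matrix.one_mul]
    rw [saltedProjector_mul_saltedProjector, smul_kronecker, map_smul, norm_smul]
    refine (mul_le_of_le_one_right (norm_nonneg _) ?_).trans (hc θ θ' hne x y)
    -- The remaining factor is a partial isometry: its `star M * M` is Alice's projector for `θ'`
    -- and `y`, tensored with the identity.
    refine norm_le_one_of_isStarProjection_star_mul_self ?_
    rw [← map_star, ← map_mul, star_kronecker_one, ← mul_kronecker_mul, Matrix.one_mul]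
    refine IsStarProjection.map (IsStarProjection.kronecker_one ?_) Φ
    have : star (saltedUnitary g θ * single x y 1 * (saltedUnitary g θ')ᴴ) *
        (saltedUnitary g θ * single x y 1 * (saltedUnitary g θ')ᴴ) = saltedProjector g θ' y := by
      have h := conjTranspose_mul_saltedUnitary g θ
      simp only [star_eq_conjTranspose, conjTranspose_mul, conjTranspose_conjTranspose,
        conjTranspose_single, star_one, saltedProjector]
      calc _ = saltedUnitary g θ' * (single y x 1 * ((saltedUnitary g θ)ᴴ * saltedUnitary g θ) *
            single x y 1) * (saltedUnitary g θ')ᴴ := by simp only [Matrix.mul_assoc]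
        _ = _ := by rw [h, Matrix.mul_one, single_mul_single_same, one_mul]
    rw [this]
    exact saltedProjector_isStarProjection g θ' y
  have hwin : ∀ θ, winOp a b d θ =
      Φ (∑ x, saltedProjector g θ x ⊗ₖ (T.bob θ x ⊗ₖ T.charlie θ x)) := by
    intro θ
    simp only [winOp, a, b, d, ← map_star, ← map_mul, star_one_kronecker, star_kronecker_one,
      ← mul_kronecker_mul, Matrix.one_mul, Matrix.mul_one, map_sum, ← hR, ← hS]
  have hκ := re_trace_mul_le T.ρ_posSemidef T.ρ_trace
    (M := ∑ θ, ∑ x, saltedProjector g θ x ⊗ₖ (T.bob θ x ⊗ₖ T.charlie θ x)) fun v => by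
      refine le_trans (le_of_eq ?_) (hcomm.sum_re_inner_winOp_le hc0 hoverlap v)
      simp only [hwin]
      rw [map_sum, _root_.sum_apply, inner_sum, Complex.re_sum]
  rw [MonogamyGame.winProb, uniformMean]
  simp only [Finset.sum_mul, trace_sum, Complex.re_sum] at hκ
  refine (div_le_div_of_nonneg_right hκ (Nat.cast_nonneg _)).trans_eq ?_
  have hcard : (Fintype.card (BitString m) : ℝ) = 2 ^ m := by simp
  rw [hcard, add_div, mul_div_cancel_left₀ _ (by positivity), Real.rpow_neg zero_le_two,
    Real.rpow_natCast, one_div]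

theorem value_saltedGame_le (g : BitString (m + n) → Bool) {c : ℝ} (hc0 : 0 ≤ c)
    (hc : ∀ θ θ', θ ≠ θ' → ∀ x y, ‖overlap g θ θ' x y‖ ≤ c) :
    (saltedGame g).value ≤ (2 : ℝ) ^ (-(m : ℝ)) + c :=
  Real.iSup_le (winProb_saltedGame_le g hc0 hc) (by positivity)

end MonogamyValue

/-! ### Overlaps as sums of signs, and agreement with the search -/

section Bias

variable {m n : ℕ}

/-- The sum of the signs `(-1)^(g(θ‖y) + g(θ'‖y) + ⟨z, y⟩)`. -/
noncomputable def biasSum (g : BitString (m + n) → Bool) (θ θ' : BitString m) (z : BitString n) : ℝ :=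
  ∑ y : BitString n, (-1 : ℝ) ^ ((g (Fin.append θ y)).toNat + (g (Fin.append θ' y)).toNat +
    ∑ i, (z i && y i).toNat)

theorem innerSign_mul_innerSign (x x' y : BitString n) :
    innerSign y x * innerSign y x' = (-1 : ℂ) ^ ∑ i, (((x i ^^ x' i) && y i).toNat) := by
  rw [innerSign, innerSign, ← Finset.prod_mul_distrib, ← Finset.prod_pow_eq_pow_sum]
  refine Finset.prod_congr rfl fun i _ => ?_
  cases x i <;> cases x' i <;> cases y i <;> simp

/-- The two Hadamard signs multiply to the character of `x ⊕ x'`. That only this XOR matters leaves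
`2^n` rather than `2^(2n)` cases per pair of salts, which the later union bound needs. -/
theorem overlap_eq (g : BitString (m + n) → Bool) (θ θ' : BitString m) (x x' : BitString n) :
    overlap g θ θ' x x' = ((2 ^ n)⁻¹ * biasSum g θ θ' fun i => x i ^^ x' i : ℝ) := by
  have hc : ((2 : ℝ) ^ (-(n : ℝ) / 2)) * ((2 : ℝ) ^ (-(n : ℝ) / 2)) = (2 ^ n)⁻¹ := by
    rw [← Real.rpow_add two_pos, add_halves, Real.rpow_neg zero_le_two, Real.rpow_natCast]
  have hU : ∀ (θ : BitString m) (y x : BitString n), saltedUnitary g θ y x =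
      (-1 : ℂ) ^ (g (Fin.append θ y)).toNat *
        ((((2 : ℝ) ^ (-(n : ℝ) / 2) : ℝ) : ℂ) * innerSign y x) := fun θ y x => by
    rw [saltedUnitary, phaseUnitary, Matrix.diagonal_mul, hadamard, Matrix.of_apply]
  have hstar : ∀ x y : BitString n, star (innerSign x y) = innerSign x y := fun x y => by
    simp [innerSign]
  rw [biasSum, overlap, Matrix.mul_apply, ← hc]
  push_cast
  rw [Finset.mul_sum]
  refine Finset.sum_congr rfl fun y _ => ?_
  rw [Matrix.conjTranspose_apply, hU, hU, star_mul', star_mul', hstar, star_pow, star_neg, star_one,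
    show star (((2 : ℝ) ^ (-(n : ℝ) / 2) : ℝ) : ℂ) = (((2 : ℝ) ^ (-(n : ℝ) / 2) : ℝ) : ℂ) from
      Complex.conj_ofReal _, pow_add, pow_add, ← innerSign_mul_innerSign]
  ring

/-- Some bias is larger than expected of a random function. -/
def IsBiased (g : BitString (m + n) → Bool) : Prop :=
  ∃ θ θ' : BitString m, θ ≠ θ' ∧ ∃ z : BitString n, 4 * (2 ^ n * (m + n)) < biasSum g θ θ' z ^ 2

theorem value_saltedGame_le_of_not_isBiased {g : BitString (m + n) → Bool} (hg : ¬ IsBiased g) :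
    (saltedGame g).value ≤ 2 * ((2 : ℝ) ^ (-(m : ℝ)) +
      (2 : ℝ) ^ (-(n : ℝ) / 2) * √((m : ℝ) + (n : ℝ))) := by
  have hm : 0 ≤ (2 : ℝ) ^ (-(m : ℝ)) := by positivity
  -- This `c` is the square root of the bias threshold `4 * (2 ^ n * (m + n))`, divided by `2 ^ n`.
  refine (value_saltedGame_le g (c := 2 * ((2 : ℝ) ^ (-(n : ℝ) / 2) * √((m : ℝ) + (n : ℝ))))
    (by positivity) fun θ θ' hne x y => ?_).trans (by linarith)
  rw [overlap_eq, Complex.norm_real, Real.norm_eq_abs]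
  refine abs_le_of_sq_le_sq ?_ (by positivity)
  have h1 : biasSum g θ θ' (fun i => x i ^^ y i) ^ 2 ≤ 4 * (2 ^ n * (m + n)) := by
    by_contra h
    exact hg ⟨θ, θ', hne, _, not_le.1 h⟩
  have hc : ((2 : ℝ) ^ (-(n : ℝ) / 2)) ^ 2 = (2 ^ n)⁻¹ := by
    rw [sq, ← Real.rpow_add two_pos, add_halves, Real.rpow_neg zero_le_two, Real.rpow_natCast]
  rw [mul_pow, mul_pow, mul_pow, hc, Real.sq_sqrt (by positivity)]
  calc ((2 : ℝ) ^ n)⁻¹ ^ 2 * _ ≤ ((2 : ℝ) ^ n)⁻¹ ^ 2 * (4 * (2 ^ n * (m + n))) :=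
        mul_le_mul_of_nonneg_left h1 (by positivity)
    _ = _ := by
        field_simp
        norm_num
        ring

/-- The bit string of the `k` lowest binary digits. -/
def bits (k v : ℕ) : BitString k := fun i => v.testBit i

theorem bits_injOn (k : ℕ) : Set.InjOn (bits k) {v | v < 2 ^ k} := by
  intro v hv w hw h
  refine Nat.eq_of_testBit_eq fun i => ?_
  by_cases hi : i < k
  · exact congrFun h ⟨i, hi⟩
  · have hk : 2 ^ k ≤ 2 ^ i := Nat.pow_le_pow_right two_pos (not_lt.1 hi)
    rw [Nat.testBit_lt_two_pow (lt_of_lt_of_le hv hk), Nat.testBit_lt_two_pow (lt_of_lt_of_le hw hk)]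

theorem bits_bijective (k : ℕ) : Function.Bijective fun v : Fin (2 ^ k) => bits k v := by
  refine (Fintype.bijective_iff_injective_and_card _).2 ⟨fun v w h => ?_, by simp⟩
  exact Fin.ext (bits_injOn k v.2 w.2 h)

theorem exists_bits_eq {k : ℕ} (x : BitString k) : ∃ v < 2 ^ k, bits k v = x :=
  let ⟨v, hv⟩ := (bits_bijective k).2 x
  ⟨v, v.2, hv⟩

/-- The oracle reads the lowest digits first, so the salt occupies the low `m` digits of a query and
`y` the next `n`. -/
theorem bitOracle_add (g : BitString (m + n) → Bool) {θ : ℕ} (hθ : θ < 2 ^ m) (y : ℕ) :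
    bitOracle g (θ + 2 ^ m * y) = g (Fin.append (bits m θ) (bits n y)) := by
  rw [bitOracle]
  congr 1
  funext i
  rw [add_comm, Nat.testBit_two_pow_mul_add _ hθ]
  refine Fin.addCases (fun j => ?_) (fun j => ?_) i
  · simp [bits]
  · simp [bits]

/-- A sign with exponent `k` is `1 - 2 * (k % 2)`, so the sum is the number of terms minus twice the
number of odd exponents. -/
theorem biasSum_bits (g : BitString (m + n) → Bool) {θ θ' : ℕ} (hθ : θ < 2 ^ m) (hθ' : θ' < 2 ^ m)
    (z : ℕ) : biasSum g (bits m θ) (bits m θ') (bits n z) =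
      2 ^ n - 2 * oddCount (bitOracle g) m n θ θ' z := by
  have hpow : ∀ k : ℕ, (-1 : ℝ) ^ k = 1 - 2 * ((k % 2 : ℕ) : ℝ) := fun k => by
    rw [neg_one_pow_eq_pow_mod_two]
    rcases Nat.mod_two_eq_zero_or_one k with h | h <;> norm_num [h]
  rw [biasSum, ← (bits_bijective n).sum_comp, oddCount, Finset.sum_range]
  simp only [hpow, bitOracle_add g hθ, bitOracle_add g hθ', andCount_eq_sum, Finset.sum_sub_distrib,
    ← Finset.mul_sum, Nat.cast_sum]
  simp [bits]

theorem isDeviant_iff (g : BitString (m + n) → Bool) {θ θ' : ℕ} (hθ : θ < 2 ^ m) (hθ' : θ' < 2 ^ m)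
    (z : ℕ) : IsDeviant (bitOracle g) m n θ θ' z ↔
      4 * (2 ^ n * (m + n)) < biasSum g (bits m θ) (bits m θ') (bits n z) ^ 2 := by
  rw [IsDeviant, biasSum_bits g hθ hθ', ← @Nat.cast_lt ℝ]
  generalize oddCount (bitOracle g) m n θ θ' z = c
  push_cast
  rw [show (2 : ℝ) ^ n = ((2 ^ n : ℕ) : ℝ) by push_cast; rfl, ← sq]
  generalize 2 ^ n = q
  rcases le_total q (2 * c) with h | h
  · rw [Nat.sub_eq_zero_of_le h, Nat.cast_sub h, Nat.cast_zero, zero_add, ← neg_sq]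
    push_cast
    ring_nf
  · rw [Nat.sub_eq_zero_of_le h, Nat.cast_sub h, Nat.cast_zero, add_zero]
    push_cast
    rfl

theorem hasDeviation_iff (g : BitString (m + n) → Bool) :
    HasDeviation (bitOracle g) m n ↔ IsBiased g := by
  constructor
  · rintro ⟨θ, hθ, θ', hθ', hne, z, -, h⟩
    exact ⟨_, _, fun he => hne (bits_injOn m hθ hθ' he), _, (isDeviant_iff g hθ hθ' z).1 h⟩
  · rintro ⟨x, x', hne, y, h⟩
    obtain ⟨θ, hθ, rfl⟩ := exists_bits_eq x
    obtain ⟨θ', hθ', rfl⟩ := exists_bits_eq x'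
    obtain ⟨z, hz, rfl⟩ := exists_bits_eq y
    exact ⟨θ, hθ, θ', hθ', fun he => hne (he ▸ rfl), z, hz, (isDeviant_iff g hθ hθ' z).2 h⟩

end Bias

/-! ### Concentration for a uniformly random function -/

section Concentration

variable {m n : ℕ}

/-- The change of variables that turns the signs of a bias sum into independent ones. -/
def twist (θ θ' : BitString m) (z : BitString n) (g : BitString (m + n) → Bool) :
    BitString (m + n) → Bool := fun w =>
  if (fun i => w (Fin.castAdd n i)) = θ then
    g w ^^ (g (Fin.append θ' fun j => w (Fin.natAdd m j)) ^^
      decide (Odd (∑ i, (z i && w (Fin.natAdd m i)).toNat)))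
  else g w

theorem twist_append_left (θ θ' : BitString m) (z : BitString n) (g : BitString (m + n) → Bool)
    (y : BitString n) : twist θ θ' z g (Fin.append θ y) = (g (Fin.append θ y) ^^
      (g (Fin.append θ' y) ^^ decide (Odd (∑ i, (z i && y i).toNat)))) := by
  simp [twist]

theorem twist_append_of_ne {θ θ₁ : BitString m} (h : θ₁ ≠ θ) (θ' : BitString m) (z : BitString n)
    (g : BitString (m + n) → Bool) (y : BitString n) :
    twist θ θ' z g (Fin.append θ₁ y) = g (Fin.append θ₁ y) := by
  simp [twist, h]

theorem exists_append_eq (w : BitString (m + n)) :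
    ∃ (θ : BitString m) (y : BitString n), Fin.append θ y = w :=
  ⟨_, _, Fin.append_castAdd_natAdd⟩

/-- Only values at salt `θ` change, and the bits added to them depend on values at `θ'` alone; as
the salts differ, a second application adds the same bits again. Hence the twist preserves the
uniform distribution. -/
theorem twist_involutive {θ θ' : BitString m} (h : θ ≠ θ') (z : BitString n) :
    Function.Involutive (twist θ θ' z) := by
  intro g
  funext w
  obtain ⟨θ₁, y, rfl⟩ := exists_append_eq w
  by_cases h₁ : θ₁ = θ
  · subst h₁
    rw [twist_append_left, twist_append_left, twist_append_of_ne h.symm]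
    generalize g (Fin.append θ₁ y) = a
    generalize g (Fin.append θ' y) = b
    generalize decide (Odd (∑ i, (z i && y i).toNat)) = c
    revert a b c
    decide
  · rw [twist_append_of_ne h₁, twist_append_of_ne h₁]

theorem biasSum_twist {θ θ' : BitString m} (h : θ ≠ θ') (z : BitString n)
    (g : BitString (m + n) → Bool) :
    biasSum (twist θ θ' z g) θ θ' z = ∑ y : BitString n, (-1 : ℝ) ^ (g (Fin.append θ y)).toNat := by
  refine Finset.sum_congr rfl fun y _ => ?_
  rw [twist_append_left, twist_append_of_ne h.symm, pow_add, pow_add]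
  rcases Nat.even_or_odd (∑ i, (z i && y i).toNat) with hs | hs
  · rw [hs.neg_one_pow, decide_eq_false (Nat.not_odd_iff_even.2 hs)]
    cases g (Fin.append θ y) <;> cases g (Fin.append θ' y) <;> simp
  · rw [hs.neg_one_pow, decide_eq_true hs]
    cases g (Fin.append θ y) <;> cases g (Fin.append θ' y) <;> simp

theorem sum_exp_biasSum {θ θ' : BitString m} (h : θ ≠ θ') (z : BitString n) (c : ℝ) :
    ∑ g, Real.exp (c * biasSum g θ θ' z) =
      Fintype.card (BitString (m + n) → Bool) * Real.cosh c ^ 2 ^ n := by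
  rw [← Equiv.sum_comp (twist_involutive h z).toPerm]
  simp only [Function.Involutive.coe_toPerm, biasSum_twist h]
  -- The exponential is a product over all inputs, trivial away from salt `θ`; summing over all
  -- functions then factors into sums over single bits.
  let φ : BitString m × BitString n → Bool → ℝ := fun p b =>
    if p.1 = θ then Real.exp (c * (-1) ^ b.toNat) else 1
  have h1 : ∀ g : BitString (m + n) → Bool,
      Real.exp (c * ∑ y : BitString n, (-1 : ℝ) ^ (g (Fin.append θ y)).toNat) =
        ∏ w, φ ((Fin.appendEquiv m n).symm w) (g w) := by
    intro g
    rw [← (Fin.appendEquiv m n).prod_comp, Fintype.prod_prod_type, Finset.mul_sum, Real.exp_sum]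
    simp only [Equiv.symm_apply_apply, φ]
    rw [Finset.prod_eq_single θ]
    · simp [Fin.appendEquiv]
    · intro θ₁ _ hne
      simp [hne]
    · simp
  have h2 : ∀ p, ∑ b, φ p b = 2 * if p.1 = θ then Real.cosh c else 1 := by
    intro p
    simp only [φ, Fintype.sum_bool, Real.cosh_eq]
    split_ifs
    · simp
      ring
    · norm_num
  simp only [h1]
  rw [← Fintype.prod_sum, ← (Fin.appendEquiv m n).prod_comp]
  simp only [Equiv.symm_apply_apply, h2, Finset.prod_mul_distrib]
  congr 1
  · simp [pow_add]
  · rw [Fintype.prod_prod_type, Finset.prod_eq_single θ]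
    · simp
    · intro θ₁ _ hne
      simp [hne]
    · simp

theorem uniformProb_eq_uniformMean {α : Type} [Fintype α] (p : α → Prop) [DecidablePred p] :
    uniformProb p = uniformMean fun a => if p a then (1 : ℝ) else 0 := by
  rw [uniformProb, uniformMean, Finset.sum_boole, Set.ncard_eq_toFinset_card']
  simp

/-- A random function is unlikely to be biased. -/
theorem uniformProb_isBiased_le :
    uniformProb (fun g : BitString (m + n) → Bool => IsBiased g) ≤ 2 * (2 : ℝ) ^ (-(n : ℝ)) := by
  classical
  set N : ℝ := ((Fintype.card (BitString (m + n) → Bool) : ℕ) : ℝ)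
  have hN : 0 < N := by positivity
  set t : ℝ := √(4 * (2 ^ n * (m + n)))
  have ht : t ^ 2 = 4 * (2 ^ n * (m + n)) := Real.sq_sqrt (by positivity)
  have ht0 : 0 ≤ t := Real.sqrt_nonneg _
  -- This is the minimiser of the Chernoff exponent `-c * t + 2 ^ n * c ^ 2 / 2`.
  set c : ℝ := t / 2 ^ n
  have hc0 : 0 ≤ c := by positivity
  -- Union bound and exponential Markov inequality, pointwise in `g`; the two exponentials cover
  -- both signs of the bias.
  have hpt : ∀ g : BitString (m + n) → Bool, (if IsBiased g then (1 : ℝ) else 0) ≤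
      ∑ θ : BitString m, ∑ θ' : BitString m, ∑ z : BitString n, if θ = θ' then 0 else
        Real.exp (-(c * t)) * (Real.exp (c * biasSum g θ θ' z) + Real.exp (-c * biasSum g θ θ' z)) := by
    intro g
    have hnn : ∀ θ θ' z, 0 ≤ if θ = θ' then 0 else Real.exp (-(c * t)) *
        (Real.exp (c * biasSum g θ θ' z) + Real.exp (-c * biasSum g θ θ' z)) := fun θ θ' z => by
      split_ifs <;> positivity
    split_ifs with hg
    · obtain ⟨θ, θ', hne, z, hz⟩ := hg
      refine le_trans ?_ (Finset.single_le_sum (fun θ _ => Finset.sum_nonneg fun θ' _ =>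
        Finset.sum_nonneg fun z _ => hnn θ θ' z) (Finset.mem_univ θ))
      refine le_trans ?_ (Finset.single_le_sum (fun θ' _ =>
        Finset.sum_nonneg fun z _ => hnn θ θ' z) (Finset.mem_univ θ'))
      refine le_trans ?_ (Finset.single_le_sum (fun z _ => hnn θ θ' z) (Finset.mem_univ z))
      rw [if_neg hne]
      have habs : t ≤ |biasSum g θ θ' z| := by
        rw [← ht] at hz
        exact (abs_of_nonneg ht0).symm.le.trans (sq_lt_sq.1 hz).le
      have hle : Real.exp (c * t) ≤
          Real.exp (c * biasSum g θ θ' z) + Real.exp (-c * biasSum g θ θ' z) := by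
        refine (Real.exp_le_exp.2 (mul_le_mul_of_nonneg_left habs hc0)).trans ?_
        rcases abs_choice (biasSum g θ θ' z) with h | h <;> rw [h]
        · linarith [Real.exp_pos (-c * biasSum g θ θ' z)]
        · rw [mul_neg, ← neg_mul]
          linarith [Real.exp_pos (c * biasSum g θ θ' z)]
      rw [Real.exp_neg, ← div_eq_inv_mul, one_le_div (Real.exp_pos _)]
      exact hle
    · exact Finset.sum_nonneg fun θ _ => Finset.sum_nonneg fun θ' _ =>
        Finset.sum_nonneg fun z _ => hnn θ θ' z
  -- By `cosh c ≤ exp (c ^ 2 / 2)` the left side is at most `exp (-4(m+n) + 2(m+n))`, and `2 ≤ e`.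
  have hexp : Real.exp (-(c * t)) * Real.cosh c ^ 2 ^ n ≤ ((2 : ℝ) ^ (2 * (m + n)))⁻¹ := by
    have hct : c * t = 4 * (m + n) := by
      rw [div_mul_eq_mul_div, ← sq, ht]
      field_simp
    have hcc : 2 ^ n * (c ^ 2 / 2) = 2 * (m + n : ℝ) := by
      rw [div_pow, ht]
      field_simp
      norm_num
      ring
    have h1 : Real.cosh c ^ 2 ^ n ≤ Real.exp (2 * (m + n : ℝ)) := by
      refine (pow_le_pow_left₀ (Real.cosh_pos c).le (Real.cosh_le_exp_half_sq c) _).trans_eq ?_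
      rw [← Real.exp_nat_mul]
      push_cast
      rw [hcc]
    calc _ ≤ Real.exp (-(c * t)) * Real.exp (2 * (m + n : ℝ)) :=
          mul_le_mul_of_nonneg_left h1 (Real.exp_pos _).le
      _ = (Real.exp 1 ^ (2 * (m + n)))⁻¹ := by
          rw [← Real.exp_add, hct, ← Real.exp_nat_mul, ← Real.exp_neg]
          push_cast
          ring_nf
      _ ≤ _ := by
          refine inv_anti₀ (by positivity) (pow_le_pow_left₀ zero_le_two ?_ _)
          linarith [Real.add_one_le_exp 1]
  have hterm : ∀ (θ θ' : BitString m) (z : BitString n),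
      ∑ g : BitString (m + n) → Bool, (if θ = θ' then 0 else
        Real.exp (-(c * t)) * (Real.exp (c * biasSum g θ θ' z) + Real.exp (-c * biasSum g θ θ' z))) ≤
      2 * N * ((2 : ℝ) ^ (2 * (m + n)))⁻¹ := by
    intro θ θ' z
    split_ifs with h
    · rw [Finset.sum_const_zero]; positivity
    · rw [← Finset.mul_sum, Finset.sum_add_distrib, sum_exp_biasSum h, sum_exp_biasSum h,
        Real.cosh_neg]
      nlinarith
  rw [uniformProb_eq_uniformMean, uniformMean, div_le_iff₀ hN]
  refine (Finset.sum_le_sum fun g _ => hpt g).trans ?_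
  rw [Finset.sum_comm]
  refine (Finset.sum_le_sum fun θ _ => (Finset.sum_comm.trans_le (Finset.sum_le_sum fun θ' _ =>
    Finset.sum_comm.trans_le (Finset.sum_le_sum fun z _ => hterm θ θ' z)))).trans_eq ?_
  -- The `2^(2m+n)` triples contribute `2 * 2^(-2(m+n))` each, in total `2 * 2^(-n)`.
  simp only [Finset.sum_const, Finset.card_univ, Fintype.card_pi, Fintype.card_bool,
    Finset.prod_const, Fintype.card_fin, nsmul_eq_mul]
  rw [Real.rpow_neg zero_le_two, Real.rpow_natCast]
  push_cast
  field_simp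
  ring

end Concentration

/-! ### Transfer from random functions to the keyed family -/

section Conclusion

theorem runsInPolyTimeOf_distinguisher (m n : ℕ → ℕ) :
    RunsInPolyTimeOf distinguisher m n fun ℓ => 2 ^ (m ℓ + n ℓ) := by
  refine ⟨1500 * (Polynomial.X + 1) ^ 6, fun ℓ f ω => ?_⟩
  obtain ⟨t, ρ', ω', he, ht, -⟩ := reaches_distinguisher (O := bitOracle f)
    (ρ := (startState ℓ (m ℓ) (n ℓ) ω).reg) (m := m ℓ) (n := n ℓ) rfl rfl ω
  exact ⟨t, _, he, by simpa using ht⟩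

open Classical in
theorem acceptProb_distinguisher (ℓ : ℕ) {m n : ℕ} (g : BitString (m + n) → Bool) :
    acceptProb distinguisher ℓ g = if IsBiased g then 1 else 0 := by
  have h : {ω | ∃ t s', Exec (bitOracle g) distinguisher (startState ℓ m n ω) t s' ∧
      s'.reg 0 ≠ 0} = {_ω : ℕ → Bool | IsBiased g} := by
    ext ω
    obtain ⟨t, ρ', ω', he, -, hQ⟩ := reaches_distinguisher (O := bitOracle g)
      (ρ := (startState ℓ m n ω).reg) (m := m) (n := n) rfl rfl ω
    rw [hasDeviation_iff] at hQ
    refine ⟨?_, fun hb => ⟨t, _, he, hQ.2 hb⟩⟩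
    rintro ⟨t', s', he', h0⟩
    -- Acceptance asks for some accepting run; determinism identifies it with the run already
    -- constructed, so the coins play no role and the probability is `0` or `1`.
    cases he.deterministic he'
    exact hQ.1 h0
  have : IsProbabilityMeasure coinMeasure := by
    unfold coinMeasure
    infer_instance
  rw [acceptProb, h]
  split_ifs with hb <;> simp [hb]

theorem uniformProb_mono {α : Type} [Fintype α] {p q : α → Prop} (h : ∀ a, p a → q a) :
    uniformProb p ≤ uniformProb q :=
  div_le_div_of_nonneg_right (by exact_mod_cast Set.ncard_le_ncard h (Set.toFinite _))
    (Nat.cast_nonneg _)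

theorem uniformProb_not {α : Type} [Fintype α] [Nonempty α] (p : α → Prop) :
    uniformProb (fun a => ¬ p a) = 1 - uniformProb p := by
  have h := Set.ncard_add_ncard_compl {a | p a} (Set.toFinite _) (Set.toFinite _)
  have h0 : (Fintype.card α : ℝ) ≠ 0 := by positivity
  rw [Nat.card_eq_fintype_card, ← @Nat.cast_inj ℝ, Nat.cast_add] at h
  rw [uniformProb, uniformProb, eq_sub_iff_add_eq, ← add_div, div_eq_one_iff_eq h0, ← h, add_comm]
  rfl

end Conclusion

theorem mainTheorem7 :
    ∃ C : ℝ, 0 < C ∧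
      ∀ (m n : ℕ → ℕ) (F : ∀ ℓ : ℕ, BitString ℓ → BitString (m ℓ + n ℓ) → Bool) (ε : ℕ → ℝ),
        IsClassicallySecurePRF F (fun ℓ => 2 ^ (m ℓ + n ℓ)) ε →
          ∀ᶠ ℓ in atTop,
            1 - C * (2 : ℝ) ^ (-(n ℓ : ℝ)) - ε ℓ ≤
              uniformProb fun k : BitString ℓ =>
                (saltedGame (F ℓ k)).value ≤
                  C * ((2 : ℝ) ^ (-(m ℓ : ℝ)) +
                    (2 : ℝ) ^ (-(n ℓ : ℝ) / 2) * √((m ℓ : ℝ) + (n ℓ : ℝ))) := by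
  classical
  refine ⟨2, two_pos, fun m n F ε hF => ?_⟩
  filter_upwards [hF distinguisher (runsInPolyTimeOf_distinguisher m n)] with ℓ hℓ
  have hrandom := uniformProb_isBiased_le (m := m ℓ) (n := n ℓ)
  -- Only one direction is needed: keyed functions are biased at most `ε` more often than random
  -- ones.
  have hadv := (abs_le.1 (show |_| ≤ _ from hℓ)).2
  simp only [acceptProb_distinguisher] at hadv
  rw [← uniformProb_eq_uniformMean (fun k => IsBiased (F ℓ k)),
    ← uniformProb_eq_uniformMean (fun g : BitString (m ℓ + n ℓ) → Bool => IsBiased g)] at hadv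
  calc 1 - 2 * (2 : ℝ) ^ (-(n ℓ : ℝ)) - ε ℓ ≤ 1 - uniformProb (fun k => IsBiased (F ℓ k)) := by
        linarith
    _ = uniformProb (fun k => ¬ IsBiased (F ℓ k)) := (uniformProb_not _).symm
    _ ≤ _ := uniformProb_mono fun k hk => value_saltedGame_le_of_not_isBiased hk
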